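/- **Setting.** Let $a,b\in\mathbb Z^2$ be linearly independent. Consider the triangular lattice on the torus $\mathbb R^2/(\mathbb Za+\mathbb Zb)$: its vertices are $V=\mathbb Z^2/(\mathbb Za+\mathbb Zb)$, and from every vertex $v$ start a horizontal edge to $v+(1,0)$, an oblique edge to $v+(1,1)$ and a vertical edge to $v+(0,1)$. Let $\mathcal A$ be a complex matrix acting on the space with a basis enumerated by the edges, written in blocks in the order horizontal, oblique, vertical. $\mathcal A$ is *local* if the basis vector of every edge ending at $v$ is mapped to a linear combination of the basis vectors of the three edges starting at $v$. *Kagome factorization.* Replace each vertex $v$ by a triangle with three vertices: at $v_3$ the oblique and vertical edges ending at $v$ come in, and an internal oblique and an internal vertical edge go out; at $v_2$ the horizontal edge ending at $v$ and the internal vertical edge come in, and an internal horizontal edge and the vertical edge starting at $v$ go out; at $v_1$ the internal horizontal and oblique edges come in, and the horizontal and oblique edges starting at $v$ go out. This gives a kagome lattice. Attach to each $v_i$ a complex $2\times2$ matrix $M_i(v)$, with rows indexed by the outgoing and columns by the incoming edges, each in the order horizontal, oblique, vertical. Let $\mathcal A_i$ be the matrix acting on the edge space through all the $M_i(v)$ and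 as the identity on the remaining block, so that $\mathcal A_1,\mathcal A_2,\mathcal A_3$ act nontrivially only in the blocks horizontal+oblique, horizontal+vertical and oblique+vertical, respectively; the internal edges of the triangle at $v$ are labelled by the edges of the same direction ending at $v$. These data *factorize* $\mathcal A$ if $\mathcal A=\mathcal A_1\mathcal A_2\mathcal A_3$. *Evolution.* One step of discrete time takes a block matrix $\mathcal A=\mathcal A_1\mathcal A_2\mathcal A_3$, where $\mathcal A_1,\mathcal A_2,\mathcal A_3$ are matrices acting as the identity on the vertical, oblique and horizontal block, respectively, to $\mathcal A_3\mathcal A_2\mathcal A_1$; all matrices are considered up to conjugation by nondegenerate block-diagonal matrices (gauge transformations, which include relabellings of edges of the same direction). *Statistical sum.* Each edge of the kagome lattice either carries an arrow (directed to the right, northeastwards or upwards) or not. The weight of a kagome vertex with matrix $M=(M_{jk})_{j,k\in\{0,1\}}$ is $1$ if it has no arrows, $M_{jk}$ if exactly one arrow enters, along edge $k$, and exactly one leaves, along edge $j$, $M_{10}M_{01}-M_{00}M_{11}$ if all four edges carry arrows, and $0$ otherwise. An edge without an arrow has weight $1$; a horizontal, oblique or vertical edge with an arrow has weight $u^{-1/2}$,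 $u^{-1/2}w^{-1/2}$ or $w^{-1/2}$, respectively. $S(u,w)$ is the sum over all arrow configurations of the product of all vertex and edge weights. Put $$I(u,w)=\det(\mathbf 1-\mathcal A\Lambda^{-1}),\qquad \Lambda=\operatorname{diag}(u\mathbf 1,\,uw\mathbf 1,\,w\mathbf 1),\qquad x=u^{-a_1}w^{-a_2},\qquad y=u^{-b_1}w^{-b_2}.$$ **Theorem.** Let $\mathcal A$ be local and factorized over the kagome lattice, and let $S$, $I$ be as above. Let $u,w,x,y$ range over the nonzero complex numbers. 1. $S(u,w)$ does not depend on the choice of the square roots of $u$ and $w$. If a local matrix $\mathcal A'$ is obtained from $\mathcal A$ by any number of steps of the evolution and is factorized over the kagome lattice in any way, then the corresponding statistical sum satisfies $S'(u,w)=S(u,w)$ for all $u,w$. 2. $I(u,w)=0$ if and only if $(u,uw,w)$ lies on the finite part $\{(u,v,w):\det(\mathcal A-\operatorname{diag}(u\mathbf 1,v\mathbf 1,w\mathbf 1))=0,\ v=uw\}$ of the invariant curve of $\mathcal A$. 3. There are unique functions $s,f$ of nonzero complex $x,y$ with $s(x,y)=S(u,w)$ and $f(x,y)=I(u,w)$ for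 all $u,w$, and for all $x,y$ $$s(x,y)=\tfrac12\bigl(-f(x,y)+f(-x,y)+f(x,-y)+f(-x,-y)\bigr),$$ $$f(x,y)=\tfrac12\bigl(-s(x,y)+s(-x,y)+s(x,-y)+s(-x,-y)\bigr).$$ -/

import Mathlib

/-- The three kinds of lattice edges (and the three blocks of the matrices, in the order
`horizontal`, `oblique`, `vertical`). -/
inductive Direction
  | horizontal
  | oblique
  | vertical
  deriving DecidableEq

instance : Fintype Direction where
  elems := {.horizontal, .oblique, .vertical}
  complete d := by cases d <;> simp

/-- The displacement along an edge of the triangular lattice on `ℤ²`: to the right,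
northeastwards, upwards. -/
def Direction.step : Direction → ℤ × ℤ
  | .horizontal => (1, 0)
  | .oblique => (1, 1)
  | .vertical => (0, 1)

/-- A torus `ℝ² / (ℤa + ℤb)` carrying the triangular lattice: `a, b ∈ ℤ²` are linearly
independent periods; their classes are the basis cycles of the torus. -/
structure TorusLattice where
  a : ℤ × ℤ
  b : ℤ × ℤ
  indep : a.1 * b.2 - a.2 * b.1 ≠ 0

namespace TorusLattice

/-- The vertices of the triangular lattice on the torus. -/
abbrev Vertex (T : TorusLattice) : Type :=
  (ℤ × ℤ) ⧸ AddSubgroup.closure ({T.a, T.b} : Set (ℤ × ℤ))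

theorem finite_vertex (T : TorusLattice) : Finite T.Vertex := by
  set D := T.a.1 * T.b.2 - T.a.2 * T.b.1 with hD
  have hD0 : 0 < |D| := abs_pos.mpr T.indep
  let H := AddSubgroup.closure ({T.a, T.b} : Set (ℤ × ℤ))
  have ha : T.a ∈ H := AddSubgroup.subset_closure (by simp)
  have hb : T.b ∈ H := AddSubgroup.subset_closure (by simp)
  have key : ∀ i j : ℤ, (D * i, D * j) ∈ H := by
    intro i j
    have h : ((D * i, D * j) : ℤ × ℤ)
        = (i * T.b.2 - j * T.b.1) • T.a + (j * T.a.1 - i * T.a.2) • T.b := by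
      ext <;> simp only [Prod.fst_add, Prod.snd_add, Prod.smul_fst, Prod.smul_snd, smul_eq_mul]
        <;> rw [hD] <;> ring
    rw [h]
    exact H.add_mem (H.zsmul_mem ha _) (H.zsmul_mem hb _)
  let g : (Set.Ico (0 : ℤ) |D|) × (Set.Ico (0 : ℤ) |D|) → T.Vertex :=
    fun p => QuotientAddGroup.mk ((p.1 : ℤ), (p.2 : ℤ))
  refine Finite.of_surjective g ?_
  intro v
  induction v using QuotientAddGroup.induction_on with
  | H z =>
    refine ⟨(⟨z.1 % D, Int.emod_nonneg _ T.indep, Int.emod_lt_abs _ T.indep⟩,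
      ⟨z.2 % D, Int.emod_nonneg _ T.indep, Int.emod_lt_abs _ T.indep⟩), ?_⟩
    refine QuotientAddGroup.eq.mpr ?_
    have h : -((z.1 % D, z.2 % D) : ℤ × ℤ) + z = (D * (z.1 / D), D * (z.2 / D)) := by
      ext
      · have := Int.emod_add_mul_ediv z.1 D
        simp only [Prod.fst_add, Prod.fst_neg]; linarith
      · have := Int.emod_add_mul_ediv z.2 D
        simp only [Prod.snd_add, Prod.snd_neg]; linarith
    show -((z.1 % D, z.2 % D) : ℤ × ℤ) + z ∈ H
    rw [h]
    exact key _ _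

noncomputable instance (T : TorusLattice) : Fintype T.Vertex :=
  @Fintype.ofFinite _ T.finite_vertex

noncomputable instance (T : TorusLattice) : DecidableEq T.Vertex := Classical.decEq _

/-- The vertex reached from `v` along the edge of direction `d` that starts at `v`. -/
def next (T : TorusLattice) (d : Direction) (v : T.Vertex) : T.Vertex :=
  v + QuotientAddGroup.mk d.step

/-- The edges of the triangular lattice. The pair `(d, v)` is the edge of direction `d` that
*ends* at `v`; so the edge of direction `d` that *starts* at `v` is `(d, T.next d v)`. -/
abbrev Edge (T : TorusLattice) : Type := Direction × T.Vertex

/-- Complex matrices acting on the space whose basis is enumerated by the edges. The entry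
`A e' e` is the coefficient of (the basis vector of) `e'` in the image of `e`. -/
abbrev EdgeMatrix (T : TorusLattice) : Type := Matrix T.Edge T.Edge ℂ

/-- Locality: the edge ending at `v` is sent to a combination of the three edges that start
at `v`. -/
def IsLocal (T : TorusLattice) (A : T.EdgeMatrix) : Prop :=
  ∀ (d d' : Direction) (v v' : T.Vertex), v' ≠ T.next d' v → A (d', v') (d, v) = 0

/-- `M` coincides with the identity in the rows and columns of the block `d`, i.e. it acts
nontrivially only in the direct sum of the two other blocks. -/
def IsTrivialOn (T : TorusLattice) (d : Direction) (M : T.EdgeMatrix) : Prop :=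
  ∀ e e' : T.Edge, (e.1 = d ∨ e'.1 = d) → M e' e = (1 : T.EdgeMatrix) e' e

/-- A gauge transformation: conjugation by a non-degenerate block-diagonal matrix. -/
def GaugeEquivalent (T : TorusLattice) (B B' : T.EdgeMatrix) : Prop :=
  ∃ G : (T.EdgeMatrix)ˣ, (∀ e e' : T.Edge, e.1 ≠ e'.1 → (G : T.EdgeMatrix) e' e = 0) ∧
    B' = ((G⁻¹ : (T.EdgeMatrix)ˣ) : T.EdgeMatrix) * B * (G : T.EdgeMatrix)

/-- One step of the evolution, up to gauge: factorize `A = A₁ A₂ A₃`, reverse the order of the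
factors. (The relabelling of the edges of the new lattice is a gauge transformation.) -/
def EvolutionStep (T : TorusLattice) (A A' : T.EdgeMatrix) : Prop :=
  ∃ A₁ A₂ A₃ : T.EdgeMatrix,
    T.IsTrivialOn .vertical A₁ ∧ T.IsTrivialOn .oblique A₂ ∧ T.IsTrivialOn .horizontal A₃ ∧
    A = A₁ * A₂ * A₃ ∧ T.GaugeEquivalent (A₃ * A₂ * A₁) A'

/-- `T.EvolvesIn k A A'`: the gauge class of `A` is carried to that of `A'` in `k` steps of
discrete time. -/
inductive EvolvesIn (T : TorusLattice) : ℕ → T.EdgeMatrix → T.EdgeMatrix → Prop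
  | zero (A A' : T.EdgeMatrix) : T.GaugeEquivalent A A' → EvolvesIn T 0 A A'
  | succ (k : ℕ) (A A' A'' : T.EdgeMatrix) :
      EvolvesIn T k A A' → T.EvolutionStep A' A'' → EvolvesIn T (k + 1) A A''

/-- The block-scalar matrix with `u`, `v`, `w` on the horizontal, oblique and vertical block. -/
noncomputable def blockScalar (T : TorusLattice) (u v w : ℂ) : T.EdgeMatrix :=
  Matrix.diagonal fun e => match e.1 with
    | .horizontal => u
    | .oblique => v
    | .vertical => w

/-- The finite part of the invariant curve of `A`. -/
def invariantCurve (T : TorusLattice) (A : T.EdgeMatrix) : Set (ℂ × ℂ × ℂ) :=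
  {p | (A - T.blockScalar p.1 p.2.1 p.2.2).det = 0 ∧ p.2.1 = p.1 * p.2.2}

/-- `I(u, w) = det (1 - A Λ⁻¹)` with `Λ = diag(u, uw, w)`. -/
noncomputable def integralOfMotion (T : TorusLattice) (A : T.EdgeMatrix) (u w : ℂˣ) : ℂ :=
  (1 - A * T.blockScalar (u : ℂ)⁻¹ ((u : ℂ)⁻¹ * (w : ℂ)⁻¹) (w : ℂ)⁻¹).det

/-- The product of edge weights along the cycle `a`: a factor `u⁻¹` for each period to the
right and `w⁻¹` for each period upwards. -/
def cycleX (T : TorusLattice) (u w : ℂˣ) : ℂˣ := u ^ (-T.a.1) * w ^ (-T.a.2)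

/-- The product of edge weights along the cycle `b`. -/
def cycleY (T : TorusLattice) (u w : ℂˣ) : ℂˣ := u ^ (-T.b.1) * w ^ (-T.b.2)

end TorusLattice

/-- Matrix elements at the vertices of the kagome lattice. Each vertex `v` of the triangular
lattice is replaced by a triangle with vertices of types 1 (horizontal and oblique lines meet),
2 (horizontal and vertical lines meet), 3 (oblique and vertical lines meet). The matrix attached
to a kagome vertex has rows indexed by the outgoing and columns by the incoming edges, in the
order horizontal, oblique, vertical. -/
structure KagomeWeights (T : TorusLattice) where
  M₁ : T.Vertex → Matrix (Fin 2) (Fin 2) ℂ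
  M₂ : T.Vertex → Matrix (Fin 2) (Fin 2) ℂ
  M₃ : T.Vertex → Matrix (Fin 2) (Fin 2) ℂ

namespace KagomeWeights

variable {T : TorusLattice}

/-! In the triangle at `v` the vertices are passed in the order 3, 2, 1: the oblique and vertical
edges ending at `v` enter vertex 3 and leave it as internal edges; the horizontal edge ending at
`v` and the internal vertical edge enter vertex 2 and leave it as the internal horizontal edge and
the vertical edge starting at `v`; the internal horizontal and oblique edges enter vertex 1 and
leave it as the horizontal and oblique edges starting at `v`. In the global factors below the
internal edge of direction `d` of the triangle at `v` has the index `(d, v)`. -/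

/-- The factor acting in the horizontal and oblique blocks. -/
noncomputable def factor₁ (K : KagomeWeights T) : T.EdgeMatrix := fun e' e =>
  match e'.1, e.1 with
  | .horizontal, .horizontal => if e'.2 = T.next .horizontal e.2 then K.M₁ e.2 0 0 else 0
  | .horizontal, .oblique => if e'.2 = T.next .horizontal e.2 then K.M₁ e.2 0 1 else 0
  | .oblique, .horizontal => if e'.2 = T.next .oblique e.2 then K.M₁ e.2 1 0 else 0
  | .oblique, .oblique => if e'.2 = T.next .oblique e.2 then K.M₁ e.2 1 1 else 0
  | .vertical, .vertical => if e'.2 = e.2 then 1 else 0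
  | _, _ => 0

/-- The factor acting in the horizontal and vertical blocks. -/
noncomputable def factor₂ (K : KagomeWeights T) : T.EdgeMatrix := fun e' e =>
  match e'.1, e.1 with
  | .horizontal, .horizontal => if e'.2 = e.2 then K.M₂ e.2 0 0 else 0
  | .horizontal, .vertical => if e'.2 = e.2 then K.M₂ e.2 0 1 else 0
  | .vertical, .horizontal => if e'.2 = T.next .vertical e.2 then K.M₂ e.2 1 0 else 0
  | .vertical, .vertical => if e'.2 = T.next .vertical e.2 then K.M₂ e.2 1 1 else 0
  | .oblique, .oblique => if e'.2 = e.2 then 1 else 0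
  | _, _ => 0

/-- The factor acting in the oblique and vertical blocks. -/
noncomputable def factor₃ (K : KagomeWeights T) : T.EdgeMatrix := fun e' e =>
  match e'.1, e.1 with
  | .oblique, .oblique => if e'.2 = e.2 then K.M₃ e.2 0 0 else 0
  | .oblique, .vertical => if e'.2 = e.2 then K.M₃ e.2 0 1 else 0
  | .vertical, .oblique => if e'.2 = e.2 then K.M₃ e.2 1 0 else 0
  | .vertical, .vertical => if e'.2 = e.2 then K.M₃ e.2 1 1 else 0
  | .horizontal, .horizontal => if e'.2 = e.2 then 1 else 0
  | _, _ => 0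

/-- `K` is a factorization `A = A₁ A₂ A₃` of the local matrix `A` over the kagome lattice. -/
def Factorizes (K : KagomeWeights T) (A : T.EdgeMatrix) : Prop :=
  A = K.factor₁ * K.factor₂ * K.factor₃

/-- The edges of the kagome lattice: `Sum.inl (d, v)` is the edge of direction `d` entering the
triangle at `v` from outside, `Sum.inr (d, v)` is the edge of direction `d` inside that
triangle. -/
abbrev KagomeEdge (T : TorusLattice) : Type := T.Edge ⊕ T.Edge

/-- The free-fermion 6-vertex weight at a vertex with matrix `M`, as a function of the arrows
`i₀ i₁` on the two incoming and `o₀ o₁` on the two outgoing edges. -/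
def vertexWeight (M : Matrix (Fin 2) (Fin 2) ℂ) (i₀ i₁ o₀ o₁ : Bool) : ℂ :=
  match i₀, i₁, o₀, o₁ with
  | false, false, false, false => 1
  | true, false, true, false => M 0 0
  | true, false, false, true => M 1 0
  | false, true, true, false => M 0 1
  | false, true, false, true => M 1 1
  | true, true, true, true => M 1 0 * M 0 1 - M 0 0 * M 1 1
  | _, _, _, _ => 0

/-- The weight of an edge of direction `d` carrying an arrow, where `p = u^(1/2)` and
`q = w^(1/2)`. -/
noncomputable def arrowWeight (p q : ℂ) : Direction → ℂ
  | .horizontal => p⁻¹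
  | .oblique => p⁻¹ * q⁻¹
  | .vertical => q⁻¹

/-- The weight of an arrow configuration: the product of all vertex and edge weights. -/
noncomputable def configWeight (K : KagomeWeights T) (p q : ℂ) (σ : KagomeEdge T → Bool) : ℂ :=
  (∏ v : T.Vertex,
    vertexWeight (K.M₃ v)
        (σ (.inl (.oblique, v))) (σ (.inl (.vertical, v)))
        (σ (.inr (.oblique, v))) (σ (.inr (.vertical, v))) *
      vertexWeight (K.M₂ v)
        (σ (.inl (.horizontal, v))) (σ (.inr (.vertical, v)))
        (σ (.inr (.horizontal, v))) (σ (.inl (.vertical, T.next .vertical v))) *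
      vertexWeight (K.M₁ v)
        (σ (.inr (.horizontal, v))) (σ (.inr (.oblique, v)))
        (σ (.inl (.horizontal, T.next .horizontal v)))
        (σ (.inl (.oblique, T.next .oblique v)))) *
  ∏ e : T.Edge,
    (if σ (.inl e) then arrowWeight p q e.1 else 1) *
      (if σ (.inr e) then arrowWeight p q e.1 else 1)

/-- The statistical sum, written through square roots `p` of `u` and `q` of `w`. -/
noncomputable def statSumOfRoots (K : KagomeWeights T) (p q : ℂ) : ℂ :=
  ∑ σ : KagomeEdge T → Bool, K.configWeight p q σ

/-- The statistical sum `S(u, w)` (with the principal square roots). -/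
noncomputable def statSum (K : KagomeWeights T) (u w : ℂˣ) : ℂ :=
  K.statSumOfRoots ((u : ℂ) ^ (1 / 2 : ℂ)) ((w : ℂ) ^ (1 / 2 : ℂ))

end KagomeWeights

/-!
Both `S` and `I` are sums over the arrow configurations `σ` of the kagome lattice, with the same
terms up to signs. Expanding `det (1 - A)` over principal minors gives every configuration with
conserved arrows the product of its six-vertex weights times the sign `(-1) ^ |σ| * sign π`, where
`π` continues the arrows along paths that do not cross. This sign depends only on the homology class
`(m, n)` of `σ` on the torus: it is `(-1) ^ (m + n + m * n)`, that is, `1` if the class is divisible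
by two and `-1` otherwise. The edge weights multiply to `x ^ m * y ^ n`, so `s` and `f` are Laurent
polynomials whose coefficients differ exactly by these signs, and the inversion formulae are
identities for each monomial (`sumPoly_eq`, `detPoly_eq`).

The sign is computed on a square lattice (`SquareTorus`): at one additional point per triangle, where
an internal and an external oblique edge pass by each other, the kagome lattice can be redrawn so
that every vertex has one incoming edge from the left and one from below (`SliceBasis.grid`). All
arrows then advance from one diagonal slice of the torus to the next. Between consecutive slices the
non-crossing paths undergo a cyclic rotation, and on the way from the last slice to the first they
return to the beginning; counting inversions gives the sign in terms of the number `N` of arrows in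
a slice and the total winding `R` (`SquareTorus.sign_flow`). The pair `(N, R)` is again the homology
class, in another basis of the period lattice (`exists_homology_class`).

For the conservation of `S` it is enough, by the inversion formulae, that `I` is conserved. Gauge
transformations commute with `Λ`. For the reversal of the factors, both `det (1 - A₁ * A₂ * A₃)` and
`det (1 - A₃ * A₂ * A₁)` are Schur complements of one matrix indexed by all kagome edges, obtained
by elimination of the internal and of the external edges, respectively
(`det_fromBlocks_of_isSplit`, `det_one_sub_reverse`); `Λ` is absorbed into `A₁` and `A₃`
(`integralOfMotion_mul`).
-/

/-! ### The sign of a permutation, from its inversions -/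

/-- If the inversion sign of every pair `i < j` is `G i j * G j i`, then the sign of the
permutation is the product of `G` over all ordered pairs of different elements. -/
theorem perm_sign_eq_prod_of_inversions {α : Type*} [Fintype α] [LinearOrder α]
    (π : Equiv.Perm α) (G : α → α → ℤˣ)
    (hG : ∀ i j, i < j → (if π i < π j then (1 : ℤˣ) else -1) = G i j * G j i) :
    π.sign = ∏ i, ∏ j ∈ Finset.univ.erase i, G i j := by
  let φ : Fin (Fintype.card α) ≃o α := Fintype.orderIsoFinOfCardEq α rfl
  let ρ : Equiv.Perm (Fin (Fintype.card α)) := φ.toEquiv.permCongr.symm π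
  have hρ : ∀ i, φ (ρ i) = π (φ i) := fun i => by simp [ρ, Equiv.permCongr_def]
  have hsign : π.sign = ρ.sign := by
    refine (Equiv.Perm.sign_eq_sign_of_equiv ρ π φ.toEquiv ?_).symm
    intro x
    exact hρ x
  have hsplit : ∀ i : Fin (Fintype.card α), Finset.univ.erase i = Finset.Iio i ∪ Finset.Ioi i := by
    intro i
    ext j
    simp [lt_or_lt_iff_ne]
  have hdisj : ∀ i : Fin (Fintype.card α), Disjoint (Finset.Iio i) (Finset.Ioi i) := by
    intro i
    rw [Finset.disjoint_left]
    intro j hj hj'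
    simp only [Finset.mem_Iio, Finset.mem_Ioi] at hj hj'
    exact lt_asymm hj hj'
  have htrans : ∏ i, ∏ j ∈ Finset.univ.erase i, G i j
      = ∏ i, ∏ j ∈ Finset.univ.erase i, G (φ i) (φ j) := by
    rw [← φ.toEquiv.prod_comp (fun i => ∏ j ∈ Finset.univ.erase i, G i j)]
    refine Finset.prod_congr rfl fun i _ => ?_
    refine (Finset.prod_bij (fun j _ => φ j) ?_ ?_ ?_ ?_).symm
    · intro j hj
      simpa using hj
    · intro j _ j' _ h
      exact φ.injective h
    · intro j hj
      refine ⟨φ.symm j, ?_, by simp⟩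
      have hj' : j ≠ φ i := by simpa using hj
      simp only [Finset.mem_erase, Finset.mem_univ, and_true]
      rintro h
      exact hj' (by rw [← h]; simp)
    · intro j _
      rfl
  rw [hsign, htrans, Equiv.Perm.sign_eq_prod_prod_Ioi]
  simp_rw [hsplit, Finset.prod_union (hdisj _), Finset.prod_mul_distrib]
  have hcomm : ∏ i : Fin (Fintype.card α), ∏ j ∈ Finset.Iio i, G (φ i) (φ j)
      = ∏ j : Fin (Fintype.card α), ∏ i ∈ Finset.Ioi j, G (φ i) (φ j) :=
    Finset.prod_comm' (by simp)
  rw [hcomm, ← Finset.prod_mul_distrib]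
  refine Finset.prod_congr rfl fun i _ => ?_
  rw [← Finset.prod_mul_distrib]
  refine Finset.prod_congr rfl fun j hj => ?_
  have hij : i < j := by simpa using hj
  have h := hG (φ i) (φ j) (φ.strictMono hij)
  rw [← hρ, ← hρ] at h
  simp only [φ.lt_iff_lt] at h
  rw [h, mul_comm]

/-! ### Free-fermion six-vertex model on a torus of square type -/

/-- A square lattice on a torus, presented by diagonal slices: `move 0` goes one step to the right,
`move 1` one step up, and both pass to the next slice. There are `period` slices (`time` is the
number of the slice), a slice is a circle of length `width`, and `pos` is the position on it. The
passage from the slice `τ` to the next one shifts positions by `shift τ`, plus one for a step to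
the right. -/
structure SquareTorus (W : Type) where
  move : Fin 2 → Equiv.Perm W
  period : ℤ
  width : ℤ
  time : W → ℤ
  pos : W → ℤ
  shift : ℤ → ℤ
  period_pos : 0 < period
  width_pos : 0 < width
  time_nonneg : ∀ w, 0 ≤ time w
  time_lt : ∀ w, time w < period
  eq_of_time_pos : ∀ w w', time w = time w' → pos w = pos w' → w = w'
  time_move : ∀ d w, time (move d w) = if time w + 1 = period then 0 else time w + 1
  pos_nonneg : ∀ w, 0 ≤ pos w
  pos_lt : ∀ w, pos w < width
  pos_move : ∀ d w, pos (move d w) =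
    (pos w + shift (time w) + if d = 0 then 1 else 0) % width

namespace SquareTorus

variable {W : Type} (Q : SquareTorus W)

/-- The one-step matrix of the lattice. The index `(0, w)` stands for the horizontal and `(1, w)`
for the vertical edge that ends at `w`. -/
def stepMatrix [DecidableEq W] (M : W → Matrix (Fin 2) (Fin 2) ℂ) :
    Matrix (Fin 2 × W) (Fin 2 × W) ℂ :=
  fun e' e => if e'.2 = Q.move e'.1 e.2 then M e.2 e'.1 e.1 else 0

/-- As many arrows enter every vertex as leave it. -/
def IsBalanced (σ : Fin 2 × W → Bool) : Prop :=
  ∀ w, (σ (0, w)).toNat + (σ (1, w)).toNat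
    = (σ (0, Q.move 0 w)).toNat + (σ (1, Q.move 1 w)).toNat

/-- The product of the six-vertex weights of an arrow configuration. -/
def weight [Fintype W] (M : W → Matrix (Fin 2) (Fin 2) ℂ) (σ : Fin 2 × W → Bool) : ℂ :=
  ∏ w, KagomeWeights.vertexWeight (M w) (σ (0, w)) (σ (1, w))
    (σ (0, Q.move 0 w)) (σ (1, Q.move 1 w))

/-- The direction in which the arrow on `e` is continued: two arrows that meet at a vertex both
turn there, so that they do not cross. -/
def exit (σ : Fin 2 × W → Bool) (e : Fin 2 × W) : Fin 2 :=
  if σ (0, Q.move 0 e.2) then (if σ (1, Q.move 1 e.2) then 1 - e.1 else 0) else 1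

theorem occupied_exit {σ : Fin 2 × W → Bool} (hσ : Q.IsBalanced σ) {e : Fin 2 × W}
    (he : σ e = true) : σ (Q.exit σ e, Q.move (Q.exit σ e) e.2) = true := by
  obtain ⟨j, w⟩ := e
  have h := hσ w
  unfold exit
  fin_cases j <;> cases h1 : σ (0, Q.move 0 w) <;> cases h2 : σ (1, Q.move 1 w) <;>
    simp_all

theorem eq_of_exit_eq {σ : Fin 2 × W → Bool} (hσ : Q.IsBalanced σ) {e f : Fin 2 × W}
    (he : σ e = true) (hf : σ f = true) (h : Q.exit σ e = Q.exit σ f)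
    (hm : Q.move (Q.exit σ e) e.2 = Q.move (Q.exit σ f) f.2) : e = f := by
  obtain ⟨i, w⟩ := e
  obtain ⟨j, w'⟩ := f
  rw [h] at hm
  obtain rfl : w = w' := (Q.move _).injective hm
  have hb := hσ w
  unfold exit at h
  fin_cases i <;> fin_cases j <;> cases h1 : σ (0, Q.move 0 w) <;>
    cases h2 : σ (1, Q.move 1 w) <;> simp_all

/-- The permutation of the occupied edges that continues every arrow along its non-crossing
path. -/
noncomputable def flow [Finite W] {σ : Fin 2 × W → Bool} (hσ : Q.IsBalanced σ) :
    Equiv.Perm {e : Fin 2 × W // σ e = true} :=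
  Equiv.ofBijective
    (fun e => ⟨(Q.exit σ e, Q.move (Q.exit σ e) e.1.2), Q.occupied_exit hσ e.2⟩) <| by
    refine Finite.injective_iff_bijective.mp fun e f h => Subtype.ext ?_
    have h' := Subtype.ext_iff.mp h
    rw [Prod.ext_iff] at h'
    exact Q.eq_of_exit_eq hσ e.2 f.2 h'.1 h'.2

theorem coe_flow [Finite W] {σ : Fin 2 × W → Bool} (hσ : Q.IsBalanced σ)
    (e : {e : Fin 2 × W // σ e = true}) :
    (Q.flow hσ e : Fin 2 × W) = (Q.exit σ e, Q.move (Q.exit σ e) e.1.2) := rfl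

/-- The order of the edges: by slices, and inside a slice by position. -/
def key (e : Fin 2 × W) : ℤ ×ₗ ℤ := toLex (Q.time e.2, 2 * Q.pos e.2 + (e.1 : ℕ))

theorem key_injective : Function.Injective Q.key := by
  rintro ⟨i, w⟩ ⟨j, w'⟩ h
  have h1 := congrArg (fun p => (ofLex p).1) h
  have h2 := congrArg (fun p => (ofLex p).2) h
  simp only [key, ofLex_toLex] at h1 h2
  have hi := i.isLt
  have hj := j.isLt
  obtain rfl : w = w' := Q.eq_of_time_pos _ _ h1 (by omega)
  have : i = j := Fin.ext (by omega)
  rw [this]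

/-- How often the step from `e` in the direction `exit σ e` winds around the slice circle. -/
def wrap (σ : Fin 2 × W → Bool) (e : Fin 2 × W) : ℤ :=
  (Q.pos e.2 + Q.shift (Q.time e.2) + if Q.exit σ e = 0 then 1 else 0) / Q.width

theorem pos_move_exit (σ : Fin 2 × W → Bool) (e : Fin 2 × W) :
    Q.pos (Q.move (Q.exit σ e) e.2) = Q.pos e.2 + Q.shift (Q.time e.2)
      + (if Q.exit σ e = 0 then 1 else 0) - Q.width * Q.wrap σ e := by
  rw [Q.pos_move, wrap]
  have := Int.emod_add_mul_ediv
    (Q.pos e.2 + Q.shift (Q.time e.2) + if Q.exit σ e = 0 then 1 else 0) Q.width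
  linarith

theorem exit_lt {σ : Fin 2 × W → Bool} (hσ : Q.IsBalanced σ) {e f : Fin 2 × W}
    (he : σ e = true) (hf : σ f = true) (hw : e.2 = f.2) (hlt : e.1 < f.1) :
    Q.exit σ e = 1 ∧ Q.exit σ f = 0 := by
  obtain ⟨i, w⟩ := e
  obtain ⟨j, w'⟩ := f
  obtain rfl : w = w' := hw
  have hb := hσ w
  unfold exit
  fin_cases i <;> fin_cases j <;> cases h1 : σ (0, Q.move 0 w) <;>
    cases h2 : σ (1, Q.move 1 w) <;> simp_all

/-- The inversion sign of the pair `e < f` under the flow: paths in one slice change their order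
when exactly one of them winds around the circle once more, and paths in different slices when
exactly one of them returns from the last slice to the first. -/
theorem inversion_sign {σ : Fin 2 × W → Bool} (hσ : Q.IsBalanced σ) {e f : Fin 2 × W}
    (he : σ e = true) (hf : σ f = true) (hlt : Q.key e < Q.key f) :
    (if Q.key (Q.exit σ e, Q.move (Q.exit σ e) e.2) < Q.key (Q.exit σ f, Q.move (Q.exit σ f) f.2)
      then (1 : ℤˣ) else -1)
    = (if Q.time e.2 = Q.time f.2 then (Q.wrap σ e).negOnePow
        else if Q.time e.2 + 1 = Q.period then -1 else 1) *
      (if Q.time f.2 = Q.time e.2 then (Q.wrap σ f).negOnePow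
        else if Q.time f.2 + 1 = Q.period then -1 else 1) := by
  have hte := Q.time_lt e.2
  have htf := Q.time_lt f.2
  have hte0 := Q.time_nonneg e.2
  have htf0 := Q.time_nonneg f.2
  simp only [key, Prod.Lex.toLex_lt_toLex] at hlt ⊢
  simp only [Q.time_move]
  by_cases ht : Q.time e.2 = Q.time f.2
  · simp only [ht, if_true, lt_irrefl, false_or, true_and] at hlt ⊢
    rw [Q.pos_move_exit, Q.pos_move_exit, ht]
    -- the positions right after the vertices, where the order of the two exits is reversed
    have hQ : 2 * Q.pos e.2 + (1 - (Q.exit σ e : ℕ) : ℤ)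
        < 2 * Q.pos f.2 + (1 - (Q.exit σ f : ℕ) : ℤ) := by
      have h1 := (Q.exit σ e).isLt
      have h2 := (Q.exit σ f).isLt
      have h3 := e.1.isLt
      have h4 := f.1.isLt
      by_cases hp : Q.pos e.2 = Q.pos f.2
      · have hw := Q.eq_of_time_pos _ _ ht hp
        obtain ⟨h5, h6⟩ := Q.exit_lt hσ he hf hw (Fin.lt_def.mpr (by omega))
        rw [h5, h6, hp]
        simp
      · omega
    have hbe := Q.pos_move_exit σ e
    have hbf := Q.pos_move_exit σ f
    have r1 := Q.pos_nonneg (Q.move (Q.exit σ e) e.2)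
    have r2 := Q.pos_lt (Q.move (Q.exit σ e) e.2)
    have r3 := Q.pos_nonneg (Q.move (Q.exit σ f) f.2)
    have r4 := Q.pos_lt (Q.move (Q.exit σ f) f.2)
    have r5 := Q.pos_nonneg e.2
    have r6 := Q.pos_lt f.2
    have r7 := Q.pos_nonneg f.2
    have r8 := Q.pos_lt e.2
    have hm := Q.width_pos
    rw [hbe, ht] at r1 r2
    rw [hbf] at r3 r4
    have hv : ∀ i : Fin 2, ((i : ℕ) : ℤ) = if i = 0 then 0 else 1 := by
      intro i; fin_cases i <;> rfl
    rw [hv, hv] at hQ ⊢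
    generalize Q.wrap σ e = A at *
    generalize Q.wrap σ f = B at *
    have hAB : B - A = 0 ∨ B - A = 1 := by
      have h1 : -1 < B - A := by
        by_contra hcon
        have : Q.width * (B - A) ≤ Q.width * (-1) :=
          mul_le_mul_of_nonneg_left (by omega) hm.le
        rw [mul_sub] at this
        split_ifs at * <;> omega
      have h2 : B - A < 2 := by
        by_contra hcon
        have : Q.width * 2 ≤ Q.width * (B - A) :=
          mul_le_mul_of_nonneg_left (by omega) hm.le
        rw [mul_sub] at this
        split_ifs at * <;> omega
      omega
    rcases hAB with h | h
    · obtain rfl : B = A := by omega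
      rw [← Int.negOnePow_add, Int.negOnePow_even _ ⟨B, rfl⟩, if_pos]
      split_ifs at * <;> omega
    · obtain rfl : B = A + 1 := by omega
      rw [← Int.negOnePow_add, Int.negOnePow_odd _ ⟨A, by ring⟩, if_neg]
      rw [mul_add]
      split_ifs at * <;> omega
  · have ht' : Q.time f.2 ≠ Q.time e.2 := fun h => ht h.symm
    rw [if_neg ht, if_neg ht']
    have hlt' : Q.time e.2 < Q.time f.2 := by
      rcases hlt with h | h
      · exact h
      · exact absurd h.1 ht
    have hne : ¬ Q.time e.2 + 1 = Q.period := by omega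
    simp only [if_neg hne, one_mul]
    by_cases hl : Q.time f.2 + 1 = Q.period
    · simp only [if_pos hl]
      rw [if_neg]
      omega
    · simp only [if_neg hl]
      rw [if_pos]
      omega

end SquareTorus

namespace SquareTorus

variable {W : Type} (Q : SquareTorus W)

theorem time_coe_flow [Finite W] {σ : Fin 2 × W → Bool} (hσ : Q.IsBalanced σ)
    (e : {e : Fin 2 × W // σ e = true}) :
    Q.time (Q.flow hσ e : Fin 2 × W).2
      = if Q.time e.1.2 + 1 = Q.period then 0 else Q.time e.1.2 + 1 := by
  rw [coe_flow, Q.time_move]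

/-- The number of arrows in a slice. -/
noncomputable def sliceCard [Fintype W] (σ : Fin 2 × W → Bool) (τ : ℤ) : ℕ :=
  (Finset.univ.filter fun e : {e : Fin 2 × W // σ e = true} => Q.time e.1.2 = τ).card

/-- All slices carry the same number of arrows. -/
theorem sliceCard_eq [Fintype W] {σ : Fin 2 × W → Bool} (hσ : Q.IsBalanced σ) {τ : ℤ}
    (h0 : 0 ≤ τ) (h1 : τ < Q.period) : Q.sliceCard σ τ = Q.sliceCard σ 0 := by
  obtain ⟨n, rfl⟩ := Int.eq_ofNat_of_zero_le h0
  induction n with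
  | zero => rfl
  | succ n ih =>
    push_cast at h1
    rw [← ih (by omega) (by omega)]
    refine (Finset.card_equiv (Q.flow hσ) fun e => ?_).symm
    simp only [Finset.mem_filter, Finset.mem_univ, true_and]
    rw [Q.time_coe_flow]
    have := Q.time_nonneg e.1.2
    push_cast
    split_ifs <;> omega

/-- A slicewise sum over the arrows. -/
theorem sum_time_eq [Fintype W] {σ : Fin 2 × W → Bool} (hσ : Q.IsBalanced σ) (φ : ℤ → ℤ) :
    ∑ e : {e : Fin 2 × W // σ e = true}, φ (Q.time e.1.2)
      = Q.sliceCard σ 0 * ∑ τ ∈ Finset.Ico 0 Q.period, φ τ := by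
  have hmaps : ∀ e ∈ (Finset.univ : Finset {e : Fin 2 × W // σ e = true}),
      Q.time e.1.2 ∈ Finset.Ico 0 Q.period := fun e _ =>
    Finset.mem_Ico.mpr ⟨Q.time_nonneg _, Q.time_lt _⟩
  rw [← Finset.sum_fiberwise_of_maps_to hmaps, Finset.mul_sum]
  refine Finset.sum_congr rfl fun τ hτ => ?_
  rw [Finset.mem_Ico] at hτ
  rw [← Q.sliceCard_eq hσ hτ.1 hτ.2, sliceCard, ← nsmul_eq_mul, ← Finset.sum_const]
  refine Finset.sum_congr rfl fun e he => ?_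
  rw [(Finset.mem_filter.mp he).2]

theorem card_arrows [Fintype W] {σ : Fin 2 × W → Bool} (hσ : Q.IsBalanced σ) :
    (Fintype.card {e : Fin 2 × W // σ e = true} : ℤ) = Q.period * Q.sliceCard σ 0 := by
  have h := Q.sum_time_eq hσ (fun _ => 1)
  simp only [Finset.sum_const, Finset.card_univ, nsmul_eq_mul, mul_one, Int.card_Ico,
    sub_zero, Int.toNat_of_nonneg Q.period_pos.le] at h
  rw [h, mul_comm]

/-- The winding number of a configuration around the slice circles. -/
noncomputable def winding [Fintype W] (σ : Fin 2 × W → Bool) : ℤ :=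
  ∑ e : {e : Fin 2 × W // σ e = true}, Q.wrap σ e

/-- As the flow permutes the arrows, the sum of their positions does not change in one step. -/
theorem width_mul_winding [Fintype W] {σ : Fin 2 × W → Bool} (hσ : Q.IsBalanced σ) :
    Q.width * Q.winding σ = ∑ w, ((σ (0, w)).toNat : ℤ)
      + Q.sliceCard σ 0 * ∑ τ ∈ Finset.Ico 0 Q.period, Q.shift τ := by
  have h1 : ∑ e : {e : Fin 2 × W // σ e = true}, Q.pos (Q.move (Q.exit σ e) e.1.2)
      = ∑ e : {e : Fin 2 × W // σ e = true}, Q.pos e.1.2 :=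
    Equiv.sum_comp (Q.flow hσ) (fun e : {e : Fin 2 × W // σ e = true} => Q.pos e.1.2)
  have h2 : ∑ e : {e : Fin 2 × W // σ e = true}, (if Q.exit σ e = 0 then (1 : ℤ) else 0)
      = ∑ e : {e : Fin 2 × W // σ e = true}, if e.1.1 = 0 then (1 : ℤ) else 0 :=
    Equiv.sum_comp (Q.flow hσ)
      (fun e : {e : Fin 2 × W // σ e = true} => if e.1.1 = 0 then (1 : ℤ) else 0)
  have h3 : ∑ e : {e : Fin 2 × W // σ e = true}, (if e.1.1 = 0 then (1 : ℤ) else 0)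
      = ∑ w, ((σ (0, w)).toNat : ℤ) := by
    rw [← Finset.sum_subtype (Finset.univ.filter fun e => σ e = true) (by simp)
      (fun e : Fin 2 × W => if e.1 = 0 then (1 : ℤ) else 0), Finset.sum_filter,
      Fintype.sum_prod_type, Fin.sum_univ_two]
    simp only [if_true, Fin.one_eq_zero_iff, OfNat.ofNat_ne_one, if_false, ite_self,
      Finset.sum_const_zero, add_zero]
    refine Finset.sum_congr rfl fun w _ => ?_
    cases σ (0, w) <;> simp
  simp only [Q.pos_move_exit] at h1
  rw [Finset.sum_sub_distrib, Finset.sum_add_distrib, Finset.sum_add_distrib,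
    Q.sum_time_eq hσ, h2, h3, ← Finset.mul_sum] at h1
  rw [winding]
  linarith

/-- The sign of the flow is determined by the number `N` of arrows in a slice and by the winding
number `R`; it is the sign of `period` cyclic rotations of `N` points, with `R` the total number of
steps, and of the cyclic permutation of the slices. -/
theorem sign_flow [Fintype W] [DecidableEq W] {σ : Fin 2 × W → Bool} (hσ : Q.IsBalanced σ) :
    (Fintype.card {e : Fin 2 × W // σ e = true} : ℤ).negOnePow * (Q.flow hσ).sign
      = (Q.sliceCard σ 0 + Q.winding σ + Q.sliceCard σ 0 * Q.winding σ).negOnePow := by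
  let S := {e : Fin 2 × W // σ e = true}
  let _ : LinearOrder S :=
    LinearOrder.lift' (fun e : S => Q.key e.1) (Q.key_injective.comp Subtype.val_injective)
  let χ : S → ℤˣ := fun e => (Q.wrap σ e.1).negOnePow
  let l : S → ℤˣ := fun e => if Q.time e.1.2 + 1 = Q.period then -1 else 1
  set N := Q.sliceCard σ 0 with hN
  have hsign : (Q.flow hσ).sign = ∏ e : S, ∏ f ∈ Finset.univ.erase e,
      (if Q.time e.1.2 = Q.time f.1.2 then χ e else l e) := by
    convert! perm_sign_eq_prod_of_inversions (Q.flow hσ) _ ?_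
    intro e f hef
    have hkey : Q.key e.1 < Q.key f.1 := hef
    rw [← Q.inversion_sign hσ e.2 f.2 hkey]
    rfl
  have hslice : ∀ e : S, (Finset.univ.filter fun f : S => Q.time e.1.2 = Q.time f.1.2).card = N := by
    intro e
    rw [hN, ← Q.sliceCard_eq hσ (Q.time_nonneg e.1.2) (Q.time_lt e.1.2), sliceCard]
    congr 1
    ext f
    simp only [Finset.mem_filter, Finset.mem_univ, true_and]
    exact eq_comm
  have hsq : ∀ a : ℤˣ, a * a = 1 := Int.units_mul_self
  have hone : ∀ e : S, ∏ f ∈ Finset.univ.erase e,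
      (if Q.time e.1.2 = Q.time f.1.2 then χ e else l e)
      = χ e ^ (N + 1) * l e ^ (Fintype.card S + N) := by
    intro e
    have h1 : ∏ f : S, (if Q.time e.1.2 = Q.time f.1.2 then χ e else l e)
        = χ e ^ N * l e ^ (Fintype.card S + N) := by
      have hc := Finset.card_filter_add_card_filter_not (s := (Finset.univ : Finset S))
        (fun f : S => Q.time e.1.2 = Q.time f.1.2)
      rw [hslice, Finset.card_univ] at hc
      rw [Finset.prod_ite, Finset.prod_const, Finset.prod_const, hslice, ← hc]
      congr 1
      rw [show N + (Finset.univ.filter fun f : S => ¬Q.time e.1.2 = Q.time f.1.2).card + N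
        = (Finset.univ.filter fun f : S => ¬Q.time e.1.2 = Q.time f.1.2).card + 2 * N by ring,
        pow_add, pow_mul, sq, hsq, one_pow, mul_one]
    rw [← Finset.mul_prod_erase _ _ (Finset.mem_univ e), if_pos rfl] at h1
    rw [pow_succ', mul_assoc, ← h1, ← mul_assoc, hsq, one_mul]
  have hχ : ∏ e : S, χ e = (Q.winding σ).negOnePow := by
    have : ∀ s : Finset S, ∏ e ∈ s, χ e = (∑ e ∈ s, Q.wrap σ e.1).negOnePow := by
      intro s
      induction s using Finset.cons_induction with
      | empty => simp
      | cons a s ha ih => rw [Finset.prod_cons, Finset.sum_cons, ih, Int.negOnePow_add]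
    exact this _
  have hl : ∏ e : S, l e = (N : ℤ).negOnePow := by
    have hlast : (Finset.univ.filter fun e : S => Q.time e.1.2 + 1 = Q.period).card = N := by
      have hp := Q.period_pos
      rw [hN, ← Q.sliceCard_eq hσ (τ := Q.period - 1) (by omega) (by omega), sliceCard]
      congr 1
      ext f
      simp only [Finset.mem_filter, Finset.mem_univ, true_and]
      omega
    rw [Finset.prod_ite, Finset.prod_const, Finset.prod_const, hlast, one_pow, mul_one,
      Int.negOnePow_def, zpow_natCast]
  have hpow : ∀ (a : ℤ) (n : ℕ), a.negOnePow ^ n = (a * n).negOnePow := by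
    intro a n
    rw [Int.negOnePow_def, Int.negOnePow_def, zpow_mul, zpow_natCast]
  rw [hsign, Finset.prod_congr rfl fun e _ => hone e, Finset.prod_mul_distrib, Finset.prod_pow,
    Finset.prod_pow, hχ, hl, hpow, hpow, ← Int.negOnePow_add, ← Int.negOnePow_add,
    Int.negOnePow_eq_iff]
  have hcard := Q.card_arrows hσ
  push_cast
  rw [hcard, ← hN]
  have hNN := Int.even_mul_succ_self (N : ℤ)
  obtain ⟨c, hc⟩ := hNN
  refine ⟨Q.period * c + c - N, ?_⟩
  linear_combination (Q.period + 1) * hc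

end SquareTorus

/-- The matrix `A` with the rows outside `σ` replaced by those of the identity. Its determinant is
the principal minor of `A` on `σ`. -/
def minorMatrix {X : Type*} [DecidableEq X] (A : Matrix X X ℂ) (σ : X → Bool) : Matrix X X ℂ :=
  Matrix.of fun e' e => if σ e' = true then A e' e else (1 : Matrix X X ℂ) e' e

theorem minorMatrix_apply {X : Type*} [DecidableEq X] (A : Matrix X X ℂ) (σ : X → Bool)
    (e' e : X) : minorMatrix A σ e' e
      = if σ e' = true then A e' e else (1 : Matrix X X ℂ) e' e := rfl

/-- The determinant of `1 - A` as a signed sum of the principal minors of `A`. -/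
theorem det_one_sub_eq_sum {X : Type*} [Fintype X] [DecidableEq X] (A : Matrix X X ℂ) :
    (1 - A).det = ∑ σ : X → Bool,
      (((Fintype.card {e // σ e = true} : ℤ).negOnePow : ℤ) : ℂ) *
        (minorMatrix A σ).det := by
  have h := (Matrix.detRowAlternating (R := ℂ) (n := X)).map_add_univ (fun i => -A i)
    (fun i => (1 : Matrix X X ℂ) i)
  have h0 : (1 - A).det = Matrix.detRowAlternating
      ((fun i => -A i) + fun i => (1 : Matrix X X ℂ) i) := by
    change _ = Matrix.det _
    congr 1
    ext i j
    simp [sub_eq_neg_add]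
  rw [h0, h]
  refine Finset.sum_bij' (fun s _ => fun e => decide (e ∈ s))
    (fun σ _ => Finset.univ.filter fun e => σ e = true) (by simp) (by simp)
    (by intro s _; ext; simp) (by intro σ _; ext; simp) ?_
  intro s _
  have hpw : s.piecewise (fun i => -A i) (fun i => (1 : Matrix X X ℂ) i)
      = fun i => (if i ∈ s then (-1 : ℂ) else 1) • s.piecewise A (1 : Matrix X X ℂ) i := by
    funext i
    by_cases hi : i ∈ s
    · simp [hi, Finset.piecewise]
    · simp [hi, Finset.piecewise]
  have hmul := (Matrix.detRowAlternating (R := ℂ) (n := X)).map_smul_univ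
    (fun i => if i ∈ s then (-1 : ℂ) else 1) (s.piecewise A (1 : Matrix X X ℂ))
  rw [hpw]
  refine hmul.trans ?_
  rw [smul_eq_mul, Finset.prod_ite_mem, Finset.univ_inter, Finset.prod_const]
  congr 1
  · rw [Int.coe_negOnePow_natCast]
    simp
  · change Matrix.det _ = _
    congr 1
    ext i j
    by_cases hi : i ∈ s <;> simp [hi, minorMatrix_apply, Finset.piecewise]

namespace SquareTorus

variable {W : Type} (Q : SquareTorus W) [Fintype W]

/-- A principal minor of the step matrix: after the rows are permuted by the flow, the matrix is
block-diagonal, and the determinant of the block at a vertex is its six-vertex weight. -/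
theorem minor_eq_of_isBalanced [DecidableEq W] (M : W → Matrix (Fin 2) (Fin 2) ℂ)
    {σ : Fin 2 × W → Bool} (hσ : Q.IsBalanced σ) :
    (minorMatrix (Q.stepMatrix M) σ).det = (((Q.flow hσ).sign : ℤ) : ℂ) * Q.weight M σ := by
  let π := Equiv.Perm.ofSubtype (Q.flow hσ)
  let C : W → Matrix (Fin 2) (Fin 2) ℂ := fun w => Matrix.of fun j j' =>
    if σ (j, w) = true then M w (Q.exit σ (j, w)) j' else (1 : Matrix (Fin 2) (Fin 2) ℂ) j j'
  have hπ : (minorMatrix (Q.stepMatrix M) σ).submatrix π id = Matrix.blockDiagonal C := by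
    ext ⟨j, w⟩ ⟨j', w'⟩
    rw [Matrix.submatrix_apply, minorMatrix_apply,
      Matrix.blockDiagonal_apply, id]
    cases he : σ (j, w) with
    | true =>
      have h1 : π (j, w) = (Q.exit σ (j, w), Q.move (Q.exit σ (j, w)) w) := by
        rw [show π (j, w) = _ from
          Equiv.Perm.ofSubtype_apply_of_mem (p := fun e => σ e = true) _ he]
        rfl
      have h2 := Q.occupied_exit hσ he
      simp only at h2
      rw [h1, h2, if_pos rfl, stepMatrix]
      simp only [EmbeddingLike.apply_eq_iff_eq, C, Matrix.of_apply, he, if_true]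
      by_cases hw : w = w'
      · rw [if_pos hw, if_pos hw, hw]
      · rw [if_neg hw, if_neg hw]
    | false =>
      have h1 : π (j, w) = (j, w) :=
        Equiv.Perm.ofSubtype_apply_of_not_mem (p := fun e => σ e = true) _ (by simp [he])
      rw [h1, he]
      simp only [Bool.false_eq_true, if_false, C, Matrix.of_apply, he, Matrix.one_apply,
        Prod.mk.injEq]
      by_cases hw : w = w' <;> by_cases hj : j = j' <;> simp [hw, hj]
  have hdet := Matrix.det_permute π (minorMatrix (Q.stepMatrix M) σ)
  rw [hπ, Matrix.det_blockDiagonal, Equiv.Perm.sign_ofSubtype] at hdet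
  have hC : ∀ w, (C w).det = KagomeWeights.vertexWeight (M w) (σ (0, w)) (σ (1, w))
      (σ (0, Q.move 0 w)) (σ (1, Q.move 1 w)) := by
    intro w
    have hb := hσ w
    rw [Matrix.det_fin_two]
    simp only [C, Matrix.of_apply, exit]
    cases h1 : σ (0, w) <;> cases h2 : σ (1, w) <;> cases h3 : σ (0, Q.move 0 w) <;>
      cases h4 : σ (1, Q.move 1 w) <;>
      (simp_all [KagomeWeights.vertexWeight]; try ring)
  have hsq : ((((Q.flow hσ).sign : ℤ) : ℂ)) * (((Q.flow hσ).sign : ℤ) : ℂ) = 1 := by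
    rw [← Int.cast_mul, ← Units.val_mul, Int.units_mul_self]
    simp
  rw [weight, ← Finset.prod_congr rfl fun w _ => hC w, hdet, ← mul_assoc, hsq, one_mul]

theorem weight_eq_zero (M : W → Matrix (Fin 2) (Fin 2) ℂ) {σ : Fin 2 × W → Bool}
    (hσ : ¬ Q.IsBalanced σ) : Q.weight M σ = 0 := by
  obtain ⟨w, hw⟩ := not_forall.mp hσ
  refine Finset.prod_eq_zero (Finset.mem_univ w) ?_
  cases h1 : σ (0, w) <;> cases h2 : σ (1, w) <;> cases h3 : σ (0, Q.move 0 w) <;>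
    cases h4 : σ (1, Q.move 1 w) <;> simp_all [KagomeWeights.vertexWeight]

theorem minor_eq_zero [DecidableEq W] (M : W → Matrix (Fin 2) (Fin 2) ℂ) {σ : Fin 2 × W → Bool}
    (hσ : ¬ Q.IsBalanced σ) : (minorMatrix (Q.stepMatrix M) σ).det = 0 := by
  rw [Matrix.det_apply]
  refine Finset.sum_eq_zero fun π _ => ?_
  by_contra hne
  apply hσ
  have hprod : ∀ e, minorMatrix (Q.stepMatrix M) σ (π e) e ≠ 0 := by
    intro e he
    have h0 : ∏ i, minorMatrix (Q.stepMatrix M) σ (π i) i = 0 :=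
      Finset.prod_eq_zero (Finset.mem_univ e) he
    exact hne ((congrArg (Equiv.Perm.sign π • ·) h0).trans (smul_zero _))
  have hfix : ∀ e, σ (π e) = false → π e = e := by
    intro e he
    by_contra h
    exact hprod e (by simp [minorMatrix_apply, he, h])
  have hocc : ∀ e, σ (π e) = σ e := by
    intro e
    cases h : σ (π e) with
    | false => rw [← h, hfix e h]
    | true =>
      by_contra h'
      have h'' : σ (π (π.symm e)) = false := by simpa using Ne.symm h'
      have h2 := hfix _ h''
      rw [Equiv.apply_symm_apply] at h2
      have h3 : π e = e := by rw [Equiv.eq_symm_apply] at h2; exact h2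
      rw [h3] at h
      exact h' h.symm
  have hmove : ∀ e, σ e = true → (π e).2 = Q.move (π e).1 e.2 := by
    intro e he
    by_contra h
    refine hprod e ?_
    rw [minorMatrix_apply, if_pos (by rw [hocc, he]), stepMatrix, if_neg h]
  -- `π` maps the arrows that enter `w` onto the arrows that leave it
  intro w
  have hcard : (Finset.univ.filter fun j : Fin 2 => σ (j, w) = true).card
      = (Finset.univ.filter fun j : Fin 2 => σ (j, Q.move j w) = true).card := by
    refine Finset.card_bij' (fun j _ => (π (j, w)).1)
      (fun j _ => (π.symm (j, Q.move j w)).1) ?_ ?_ ?_ ?_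
    · intro j hj
      have hj' : σ (j, w) = true := by simpa using hj
      have h := hmove _ hj'
      simp only [Finset.mem_filter, Finset.mem_univ, true_and]
      rw [← h, Prod.mk.eta, hocc, hj']
    · intro j hj
      have hj' : σ (j, Q.move j w) = true := by simpa using hj
      have h0 : σ (π.symm (j, Q.move j w)) = true := by
        rw [← hocc, Equiv.apply_symm_apply, hj']
      have h := hmove _ h0
      rw [Equiv.apply_symm_apply] at h
      have h' := (Q.move j).injective h
      simp only [Finset.mem_filter, Finset.mem_univ, true_and]
      have h2 : ((π.symm (j, Q.move j w)).1, w) = π.symm (j, Q.move j w) := Prod.ext rfl h'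
      rw [h2, h0]
    · intro j hj
      have hj' : σ (j, w) = true := by simpa using hj
      have h := hmove _ hj'
      simp only [← h, Prod.mk.eta, Equiv.symm_apply_apply]
    · intro j hj
      have hj' : σ (j, Q.move j w) = true := by simpa using hj
      have h0 : σ (π.symm (j, Q.move j w)) = true := by
        rw [← hocc, Equiv.apply_symm_apply, hj']
      have h := hmove _ h0
      rw [Equiv.apply_symm_apply] at h
      have h' := (Q.move j).injective h
      have h2 : ((π.symm (j, Q.move j w)).1, w) = π.symm (j, Q.move j w) := Prod.ext rfl h'
      simp only [h2, Equiv.apply_symm_apply]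
  rw [Finset.card_filter, Finset.card_filter, Fin.sum_univ_two, Fin.sum_univ_two] at hcard
  cases h1 : σ (0, w) <;> cases h2 : σ (1, w) <;> cases h3 : σ (0, Q.move 0 w) <;>
    cases h4 : σ (1, Q.move 1 w) <;> simp_all

end SquareTorus

/-! ### Slices of the kagome lattice -/

/-- Diagonal coordinates for the period lattice `ℤa + ℤb`: it consists of all `(p, q)` for which
`p + q = period * N` and `p = drift * N + width * R` with integers `N`, `R`. -/
structure SliceBasis (T : TorusLattice) where
  period : ℤ
  width : ℤ
  drift : ℤ
  period_pos : 0 < period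
  width_pos : 0 < width
  mem_iff : ∀ p q : ℤ, (p, q) ∈ AddSubgroup.closure ({T.a, T.b} : Set (ℤ × ℤ)) ↔
    ∃ N R : ℤ, p + q = period * N ∧ p = drift * N + width * R

theorem mem_periods_iff (T : TorusLattice) (p q : ℤ) :
    (p, q) ∈ AddSubgroup.closure ({T.a, T.b} : Set (ℤ × ℤ)) ↔
      ∃ m n : ℤ, p = m * T.a.1 + n * T.b.1 ∧ q = m * T.a.2 + n * T.b.2 := by
  rw [AddSubgroup.mem_closure_pair]
  simp only [Prod.ext_iff, Prod.fst_add, Prod.snd_add, Prod.smul_fst, Prod.smul_snd, smul_eq_mul]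
  simp only [eq_comm]

theorem exists_pos_generator (H : AddSubgroup ℤ) {d : ℤ} (hd : d ∈ H) (hd0 : d ≠ 0) :
    ∃ g : ℤ, 0 < g ∧ ∀ x, x ∈ H ↔ ∃ n, x = g * n := by
  obtain ⟨g, hg⟩ := Int.subgroup_cyclic H
  have hmem : ∀ x, x ∈ H ↔ ∃ n, x = g * n := by
    intro x
    rw [hg, AddSubgroup.mem_closure_singleton]
    simp only [smul_eq_mul, eq_comm, mul_comm]
  have hg0 : g ≠ 0 := by
    rintro rfl
    obtain ⟨n, hn⟩ := (hmem d).mp hd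
    exact hd0 (by rw [hn, zero_mul])
  refine ⟨|g|, abs_pos.mpr hg0, fun x => ?_⟩
  rw [hmem]
  rcases abs_choice g with h | h <;> rw [h]
  exact ⟨fun ⟨n, hn⟩ => ⟨-n, by rw [hn]; ring⟩, fun ⟨n, hn⟩ => ⟨-n, by rw [hn]; ring⟩⟩

theorem nonempty_sliceBasis (T : TorusLattice) : Nonempty (SliceBasis T) := by
  set D := T.a.1 * T.b.2 - T.a.2 * T.b.1 with hD
  set H := AddSubgroup.closure ({T.a, T.b} : Set (ℤ × ℤ)) with hH
  have hDx : ((D, 0) : ℤ × ℤ) ∈ H :=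
    (mem_periods_iff T _ _).mpr ⟨T.b.2, -T.a.2, by rw [hD]; ring, by ring⟩
  have hDy : ((0, D) : ℤ × ℤ) ∈ H :=
    (mem_periods_iff T _ _).mpr ⟨-T.b.1, T.a.1, by ring, by rw [hD]; ring⟩
  let φ : ℤ × ℤ →+ ℤ := AddMonoidHom.fst ℤ ℤ + AddMonoidHom.snd ℤ ℤ
  let ψ : ℤ →+ ℤ × ℤ := (AddMonoidHom.id ℤ).prod (-AddMonoidHom.id ℤ)
  obtain ⟨g, hg, hgmem⟩ := exists_pos_generator (H.map φ) (d := D)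
    ⟨(D, 0), hDx, by simp [φ]⟩ T.indep
  obtain ⟨k, hk, hkmem⟩ := exists_pos_generator (H.comap ψ) (d := D)
    (by
      rw [AddSubgroup.mem_comap]
      have : ψ D = (D, 0) - (0, D) := by simp [ψ]
      rw [this]
      exact H.sub_mem hDx hDy) T.indep
  obtain ⟨⟨c, d⟩, hcd, hsum⟩ := (hgmem g).mpr ⟨1, by ring⟩
  have hsum' : c + d = g := hsum
  refine ⟨⟨g, k, c, hg, hk, fun p q => ⟨fun h => ?_, ?_⟩⟩⟩
  · obtain ⟨N, hN⟩ := (hgmem (p + q)).mp ⟨(p, q), h, rfl⟩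
    have h2 : p - N * c ∈ H.comap ψ := by
      rw [AddSubgroup.mem_comap]
      have : ψ (p - N * c) = (p, q) - N • (c, d) := by
        ext
        · simp [ψ]
        · simp only [ψ, AddMonoidHom.prod_apply, AddMonoidHom.neg_apply, AddMonoidHom.id_apply,
            Prod.snd_sub, Prod.smul_snd, smul_eq_mul]
          linear_combination -hN + N * hsum'
      rw [this]
      exact H.sub_mem h (H.zsmul_mem hcd _)
    obtain ⟨R, hR⟩ := (hkmem _).mp h2
    exact ⟨N, R, hN, by linear_combination hR⟩
  · rintro ⟨N, R, h1, h2⟩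
    have hkR : ψ (k * R) ∈ H := (hkmem (k * R)).mpr ⟨R, rfl⟩
    have : ((p, q) : ℤ × ℤ) = N • (c, d) + ψ (k * R) := by
      ext
      · simp only [ψ, AddMonoidHom.prod_apply, AddMonoidHom.id_apply, Prod.fst_add,
          Prod.smul_fst, smul_eq_mul]
        linear_combination h2
      · simp only [ψ, AddMonoidHom.prod_apply, AddMonoidHom.neg_apply, AddMonoidHom.id_apply,
          Prod.snd_add, Prod.smul_snd, smul_eq_mul]
        linear_combination h1 - h2 - N * hsum'
    rw [this]
    exact H.add_mem (H.zsmul_mem hcd _) hkR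

namespace SliceBasis

variable {T : TorusLattice} (B : SliceBasis T)

/-- The slice of a vertex of the triangular lattice. -/
noncomputable def time (v : T.Vertex) : ℤ := (v.out.1 + v.out.2) % B.period

/-- The position of a vertex of the triangular lattice on its slice. -/
noncomputable def pos (v : T.Vertex) : ℤ :=
  (v.out.1 - B.drift * ((v.out.1 + v.out.2) / B.period)) % B.width

theorem exists_out_eq (p q : ℤ) : ∃ N R : ℤ,
    (QuotientAddGroup.mk (p, q) : T.Vertex).out.1 = p + (B.drift * N + B.width * R) ∧
    (QuotientAddGroup.mk (p, q) : T.Vertex).out.1 + (QuotientAddGroup.mk (p, q) : T.Vertex).out.2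
      = p + q + B.period * N := by
  obtain ⟨⟨⟨p', q'⟩, hmem⟩, h⟩ := QuotientAddGroup.mk_out_eq_add
    (AddSubgroup.closure ({T.a, T.b} : Set (ℤ × ℤ))) (p, q)
  obtain ⟨N, R, h1, h2⟩ := (B.mem_iff p' q').mp hmem
  refine ⟨N, R, ?_, ?_⟩
  · rw [h, ← h2]
    rfl
  · rw [h, ← h1]
    change p + p' + (q + q') = _
    ring

theorem time_mk (p q : ℤ) : B.time (QuotientAddGroup.mk (p, q)) = (p + q) % B.period := by
  obtain ⟨N, R, -, h⟩ := B.exists_out_eq p q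
  rw [time, h, Int.add_mul_emod_self_left]

theorem pos_mk (p q : ℤ) : B.pos (QuotientAddGroup.mk (p, q))
    = (p - B.drift * ((p + q) / B.period)) % B.width := by
  obtain ⟨N, R, h1, h2⟩ := B.exists_out_eq p q
  rw [pos, h2, h1, Int.add_mul_ediv_left _ _ B.period_pos.ne',
    show p + (B.drift * N + B.width * R) - B.drift * ((p + q) / B.period + N)
      = p - B.drift * ((p + q) / B.period) + B.width * R by ring, Int.add_mul_emod_self_left]

theorem eq_of_time_pos {v v' : T.Vertex} (h1 : B.time v = B.time v') (h2 : B.pos v = B.pos v') :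
    v = v' := by
  induction v using QuotientAddGroup.induction_on with
  | H z =>
  induction v' using QuotientAddGroup.induction_on with
  | H z' =>
  obtain ⟨p, q⟩ := z
  obtain ⟨p', q'⟩ := z'
  rw [time_mk, time_mk] at h1
  rw [pos_mk, pos_mk] at h2
  refine QuotientAddGroup.eq.mpr ?_
  obtain ⟨R, hR⟩ := Int.ModEq.dvd h2
  have e1 := Int.emod_add_mul_ediv (p + q) B.period
  have e2 := Int.emod_add_mul_ediv (p' + q') B.period
  refine (B.mem_iff (-p + p') (-q + q')).mpr
    ⟨(p' + q') / B.period - (p + q) / B.period, R, ?_, ?_⟩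
  · linear_combination e1 - e2 - h1
  · linear_combination hR

theorem time_nonneg (v : T.Vertex) : 0 ≤ B.time v := Int.emod_nonneg _ B.period_pos.ne'

theorem time_lt (v : T.Vertex) : B.time v < B.period := Int.emod_lt_of_pos _ B.period_pos

theorem pos_nonneg (v : T.Vertex) : 0 ≤ B.pos v := Int.emod_nonneg _ B.width_pos.ne'

theorem pos_lt (v : T.Vertex) : B.pos v < B.width := Int.emod_lt_of_pos _ B.width_pos

/-- The shift of positions in the passage from the slice `τ` to the next one. -/
def shift (τ : ℤ) : ℤ := if τ + 1 = B.period then -B.drift else 0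

theorem succ_ediv_emod (s : ℤ) :
    (s + 1) / B.period = s / B.period + (if s % B.period + 1 = B.period then 1 else 0) ∧
    (s + 1) % B.period = if s % B.period + 1 = B.period then 0 else s % B.period + 1 := by
  have h := Int.emod_add_mul_ediv s B.period
  have h1 := Int.emod_lt_of_pos s B.period_pos
  have h2 := Int.emod_nonneg s B.period_pos.ne'
  rw [Int.ediv_emod_unique B.period_pos]
  have := B.period_pos
  split_ifs with hs
  · exact ⟨by linear_combination h - hs, le_refl _, B.period_pos⟩
  · exact ⟨by linear_combination h, by omega, by omega⟩

theorem time_next {d : Direction} (hd : d ≠ .oblique) (v : T.Vertex) :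
    B.time (T.next d v) = if B.time v + 1 = B.period then 0 else B.time v + 1 := by
  induction v using QuotientAddGroup.induction_on with
  | H z =>
  obtain ⟨p, q⟩ := z
  have h : ∃ i j, d.step = (i, j) ∧ i + j = 1 := by cases d <;> simp_all [Direction.step]
  obtain ⟨i, j, hij, hs⟩ := h
  have hn : T.next d (QuotientAddGroup.mk (p, q)) = QuotientAddGroup.mk (p + i, q + j) := by
    rw [TorusLattice.next, hij]
    rfl
  rw [hn, time_mk, time_mk, show p + i + (q + j) = p + q + 1 by linear_combination hs]
  exact (B.succ_ediv_emod _).2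

theorem pos_next {d : Direction} (hd : d ≠ .oblique) (v : T.Vertex) :
    B.pos (T.next d v)
      = (B.pos v + B.shift (B.time v) + if d = .horizontal then 1 else 0) % B.width := by
  induction v using QuotientAddGroup.induction_on with
  | H z =>
  obtain ⟨p, q⟩ := z
  have h : ∃ i j, d.step = (i, j) ∧ i + j = 1 ∧ i = if d = .horizontal then 1 else 0 := by
    cases d <;> simp_all [Direction.step]
  obtain ⟨i, j, hij, hs, hi⟩ := h
  have hn : T.next d (QuotientAddGroup.mk (p, q)) = QuotientAddGroup.mk (p + i, q + j) := by
    rw [TorusLattice.next, hij]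
    rfl
  rw [hn, pos_mk, pos_mk, time_mk, ← hi, show p + i + (q + j) = p + q + 1 by linear_combination hs,
    (B.succ_ediv_emod _).1, shift, add_assoc, Int.emod_add_emod]
  congr 1
  split_ifs <;> ring

end SliceBasis

/-- The step of a vertex of the triangular lattice along an edge of direction `d`, as a
permutation. -/
def TorusLattice.nextEquiv (T : TorusLattice) (d : Direction) : Equiv.Perm T.Vertex :=
  Equiv.addRight (QuotientAddGroup.mk d.step)

theorem TorusLattice.nextEquiv_apply (T : TorusLattice) (d : Direction) (v : T.Vertex) :
    T.nextEquiv d v = T.next d v := rfl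

theorem TorusLattice.next_vertical_horizontal (T : TorusLattice) (v : T.Vertex) :
    T.next .horizontal (T.next .vertical v) = T.next .oblique v := by
  rw [next, next, next, add_assoc, ← QuotientAddGroup.mk_add]
  rfl

namespace SliceBasis

variable {T : TorusLattice} (B : SliceBasis T)

/-- The step to the right in the square lattice. Its vertices are the kagome vertices `(1, v)`,
`(2, v)`, `(3, v)` and the points `(0, v)` where an internal and an external oblique edge pass by
each other; there the lines of the square lattice jump from one oblique line to the other. -/
noncomputable def stepRight (T : TorusLattice) : Equiv.Perm (Fin 4 × T.Vertex) where
  toFun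
    | (0, v) => (3, T.next .horizontal v)
    | (1, v) => (2, T.next .horizontal v)
    | (2, v) => (1, v)
    | (3, v) => (0, v)
  invFun
    | (0, v) => (3, v)
    | (1, v) => (2, v)
    | (2, v) => (1, (T.nextEquiv .horizontal).symm v)
    | (3, v) => (0, (T.nextEquiv .horizontal).symm v)
  left_inv := by
    rintro ⟨i, v⟩
    fin_cases i <;> simp [← TorusLattice.nextEquiv_apply]
  right_inv := by
    rintro ⟨i, v⟩
    fin_cases i <;> simp [← TorusLattice.nextEquiv_apply]

/-- The step upwards in the square lattice. -/
noncomputable def stepUp (T : TorusLattice) : Equiv.Perm (Fin 4 × T.Vertex) where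
  toFun
    | (0, v) => (1, v)
    | (1, v) => (0, T.next .vertical v)
    | (2, v) => (3, T.next .vertical v)
    | (3, v) => (2, v)
  invFun
    | (0, v) => (1, (T.nextEquiv .vertical).symm v)
    | (1, v) => (0, v)
    | (2, v) => (3, v)
    | (3, v) => (2, (T.nextEquiv .vertical).symm v)
  left_inv := by
    rintro ⟨i, v⟩
    fin_cases i <;> simp [← TorusLattice.nextEquiv_apply]
  right_inv := by
    rintro ⟨i, v⟩
    fin_cases i <;> simp [← TorusLattice.nextEquiv_apply]

theorem two_mul_emod (a k : ℤ) (hk : 0 < k) :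
    (2 * a) % (2 * k) = 2 * (a % k) ∧ (2 * a + 1) % (2 * k) = 2 * (a % k) + 1 := by
  have h := Int.emod_add_mul_ediv a k
  have h1 := Int.emod_lt_of_pos a hk
  have h2 := Int.emod_nonneg a hk.ne'
  refine ⟨Int.mul_emod_mul_of_pos _ _ (by norm_num), ?_⟩
  rw [show 2 * a + 1 = 2 * (a % k) + 1 + 2 * k * (a / k) by linear_combination -2 * h,
    Int.add_mul_emod_self_left, Int.emod_eq_of_lt (by omega) (by omega)]

/-- The slice of a vertex of the square lattice. -/
noncomputable def gridTime (w : Fin 4 × T.Vertex) : ℤ :=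
  match w with
  | (0, v) => 2 * B.time v + 1
  | (1, v) => 2 * B.time (T.next .horizontal v)
  | (2, v) => 2 * B.time v + 1
  | (3, v) => 2 * B.time v

/-- The position of a vertex of the square lattice on its slice. -/
noncomputable def gridPos (w : Fin 4 × T.Vertex) : ℤ :=
  match w with
  | (0, v) => 2 * B.pos v + 1
  | (1, v) => 2 * B.pos (T.next .horizontal v)
  | (2, v) => 2 * B.pos v
  | (3, v) => 2 * B.pos v + 1

/-- The square lattice on the torus whose vertices are those of the kagome lattice and the passing
points of the oblique edges. It has two slices for every slice of the triangular lattice. -/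
noncomputable def grid : SquareTorus (Fin 4 × T.Vertex) where
  move d := if d = 0 then stepRight T else stepUp T
  period := 2 * B.period
  width := 2 * B.width
  time := B.gridTime
  pos := B.gridPos
  shift τ := if τ % 2 = 0 then -1 else 1 + 2 * B.shift (τ / 2)
  period_pos := by have := B.period_pos; omega
  width_pos := by have := B.width_pos; omega
  time_nonneg := by
    rintro ⟨i, v⟩
    have h1 := B.time_nonneg v
    have h2 := B.time_nonneg (T.next .horizontal v)
    fin_cases i <;> simp only [gridTime] <;> omega
  time_lt := by
    rintro ⟨i, v⟩
    have h1 := B.time_lt v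
    have h2 := B.time_lt (T.next .horizontal v)
    fin_cases i <;> simp only [gridTime] <;> omega
  pos_nonneg := by
    rintro ⟨i, v⟩
    have h1 := B.pos_nonneg v
    have h2 := B.pos_nonneg (T.next .horizontal v)
    fin_cases i <;> simp only [gridPos] <;> omega
  pos_lt := by
    rintro ⟨i, v⟩
    have h1 := B.pos_lt v
    have h2 := B.pos_lt (T.next .horizontal v)
    fin_cases i <;> simp only [gridPos] <;> omega
  eq_of_time_pos := by
    rintro ⟨i, v⟩ ⟨j, v'⟩ h1 h2
    fin_cases i <;> fin_cases j <;> simp only [gridTime, gridPos] at h1 h2 <;> first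
      | (exfalso; omega)
      | (rw [B.eq_of_time_pos (v := v) (v' := v') (by omega) (by omega)])
      | (rw [(T.nextEquiv .horizontal).injective (a₁ := v) (a₂ := v')
          (B.eq_of_time_pos (v := T.next .horizontal v) (v' := T.next .horizontal v')
            (by omega) (by omega))])
  time_move := by
    rintro d ⟨i, v⟩
    have hh := B.time_next (d := .horizontal) (by simp) v
    have hv := B.time_next (d := .vertical) (by simp) v
    fin_cases d <;> fin_cases i <;>
      simp [gridTime, stepRight, stepUp, hh, hv] <;> split_ifs <;> omega
  pos_move := by
    rintro d ⟨i, v⟩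
    have hh := B.pos_next (d := .horizontal) (by simp) v
    have hv := B.pos_next (d := .vertical) (by simp) v
    have h0 : ∀ a : ℤ, (2 * a) % (2 * B.width) = 2 * (a % B.width) :=
      fun a => (two_mul_emod a _ B.width_pos).1
    have h1 : ∀ a : ℤ, (2 * a + 1) % (2 * B.width) = 2 * (a % B.width) + 1 :=
      fun a => (two_mul_emod a _ B.width_pos).2
    have p1 := Int.emod_eq_of_lt (B.pos_nonneg v) (B.pos_lt v)
    have p2 := Int.emod_eq_of_lt (B.pos_nonneg (T.next .horizontal v))
      (B.pos_lt (T.next .horizontal v))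
    have q1 : ∀ t : ℤ, (2 * t + 1) / 2 = t := fun t => by omega
    have q2 : ∀ t : ℤ, (2 * t + 1) % 2 = 1 := fun t => by omega
    have q3 : ∀ t : ℤ, (2 * t) % 2 = 0 := fun t => by omega
    simp only [reduceCtorEq, if_false, if_true, add_zero] at hh hv
    fin_cases d <;> fin_cases i <;>
      simp [gridTime, gridPos, stepRight, stepUp, q1, q2, q3]
    · rw [hh, show 2 * B.pos v + 1 + (1 + 2 * B.shift (B.time v)) + 1
        = 2 * (B.pos v + B.shift (B.time v) + 1) + 1 by ring, h1]
    · exact p2.symm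
    · rw [hh, show 2 * B.pos v + (1 + 2 * B.shift (B.time v)) + 1
        = 2 * (B.pos v + B.shift (B.time v) + 1) by ring, h0]
    · rw [h1, p1]
    · rw [hh, show 2 * B.pos v + 1 + (1 + 2 * B.shift (B.time v))
        = 2 * (B.pos v + B.shift (B.time v) + 1) by ring, h0]
    · have e := Int.emod_add_mul_ediv (B.pos v + B.shift (B.time v) + 1) B.width
      rw [hh, hv, show 2 * ((B.pos v + B.shift (B.time v) + 1) % B.width) + -1
        = 2 * (B.pos v + B.shift (B.time v)) + 1
          + 2 * B.width * -((B.pos v + B.shift (B.time v) + 1) / B.width) by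
        linear_combination 2 * e, Int.add_mul_emod_self_left, h1]
    · rw [hv, show 2 * B.pos v + (1 + 2 * B.shift (B.time v))
        = 2 * (B.pos v + B.shift (B.time v)) + 1 by ring, h1]
    · exact p1.symm

end SliceBasis

/-! ### Arrow configurations on the kagome lattice -/

namespace KagomeWeights

variable {T : TorusLattice}

/-- The product of the vertex weights of an arrow configuration on the kagome lattice. -/
noncomputable def vertexProduct (K : KagomeWeights T) (σ : KagomeEdge T → Bool) : ℂ :=
  ∏ v : T.Vertex,
    vertexWeight (K.M₃ v)
        (σ (.inl (.oblique, v))) (σ (.inl (.vertical, v)))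
        (σ (.inr (.oblique, v))) (σ (.inr (.vertical, v))) *
      vertexWeight (K.M₂ v)
        (σ (.inl (.horizontal, v))) (σ (.inr (.vertical, v)))
        (σ (.inr (.horizontal, v))) (σ (.inl (.vertical, T.next .vertical v))) *
      vertexWeight (K.M₁ v)
        (σ (.inr (.horizontal, v))) (σ (.inr (.oblique, v)))
        (σ (.inl (.horizontal, T.next .horizontal v)))
        (σ (.inl (.oblique, T.next .oblique v)))

/-- The matrices at the vertices of the square lattice. At a passing point the two arrows just
change their directions, without any interaction. -/
def gridMatrix (K : KagomeWeights T) (w : Fin 4 × T.Vertex) : Matrix (Fin 2) (Fin 2) ℂ :=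
  match w with
  | (0, _) => !![0, 1; 1, 0]
  | (1, v) => K.M₁ v
  | (2, v) => K.M₂ v
  | (3, v) => K.M₃ v

/-- The configuration on the square lattice given by a configuration on the kagome lattice. Every
oblique edge consists of two edges of the square lattice, which meet at a passing point. -/
noncomputable def gridConfig (σ : KagomeEdge T → Bool) (e : Fin 2 × (Fin 4 × T.Vertex)) : Bool :=
  match e with
  | (0, (0, v)) => σ (.inr (.oblique, v))
  | (1, (0, v)) => σ (.inl (.oblique, T.next .horizontal v))
  | (0, (1, v)) => σ (.inr (.horizontal, v))
  | (1, (1, v)) => σ (.inr (.oblique, v))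
  | (0, (2, v)) => σ (.inl (.horizontal, v))
  | (1, (2, v)) => σ (.inr (.vertical, v))
  | (0, (3, v)) => σ (.inl (.oblique, v))
  | (1, (3, v)) => σ (.inl (.vertical, v))

/-- The configuration on the kagome lattice read off from one on the square lattice. -/
def ofGridConfig (ρ : Fin 2 × (Fin 4 × T.Vertex) → Bool) (e : KagomeEdge T) : Bool :=
  match e with
  | .inl (.horizontal, v) => ρ (0, (2, v))
  | .inl (.oblique, v) => ρ (0, (3, v))
  | .inl (.vertical, v) => ρ (1, (3, v))
  | .inr (.horizontal, v) => ρ (0, (1, v))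
  | .inr (.oblique, v) => ρ (1, (1, v))
  | .inr (.vertical, v) => ρ (1, (2, v))

theorem ofGridConfig_gridConfig (σ : KagomeEdge T → Bool) : ofGridConfig (gridConfig σ) = σ := by
  funext e
  rcases e with ⟨d, v⟩ | ⟨d, v⟩ <;> cases d <;> rfl

theorem vertexWeight_swap (i₀ i₁ o₀ o₁ : Bool) :
    vertexWeight !![0, 1; 1, 0] i₀ i₁ o₀ o₁ = if i₀ = o₁ ∧ i₁ = o₀ then 1 else 0 := by
  cases i₀ <;> cases i₁ <;> cases o₀ <;> cases o₁ <;> simp [vertexWeight]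

variable (B : SliceBasis T)

theorem weight_gridConfig (K : KagomeWeights T) (σ : KagomeEdge T → Bool) :
    B.grid.weight K.gridMatrix (gridConfig σ) = K.vertexProduct σ := by
  rw [SquareTorus.weight, Fintype.prod_prod_type, Fin.prod_univ_four, vertexProduct,
    ← Finset.prod_mul_distrib, ← Finset.prod_mul_distrib, ← Finset.prod_mul_distrib]
  refine Finset.prod_congr rfl fun v _ => ?_
  simp only [SliceBasis.grid, SliceBasis.stepRight, SliceBasis.stepUp, gridMatrix, gridConfig,
    if_true, one_ne_zero, if_false, Equiv.coe_fn_mk, vertexWeight_swap, and_self,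
    T.next_vertical_horizontal]
  ring

/-- A configuration of non-zero weight on the square lattice comes from the kagome lattice. -/
theorem gridConfig_ofGridConfig (K : KagomeWeights T) {ρ : Fin 2 × (Fin 4 × T.Vertex) → Bool}
    (hρ : B.grid.weight K.gridMatrix ρ ≠ 0) : gridConfig (ofGridConfig ρ) = ρ := by
  have hpass : ∀ v, ρ (0, (0, v)) = ρ (1, (1, v)) ∧
      ρ (1, (0, v)) = ρ (0, (3, T.next .horizontal v)) := by
    intro v
    by_contra hcon
    refine hρ (Finset.prod_eq_zero (Finset.mem_univ ((0, v) : Fin 4 × T.Vertex)) ?_)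
    simp only [SliceBasis.grid, SliceBasis.stepRight, SliceBasis.stepUp, gridMatrix,
      if_true, one_ne_zero, if_false, Equiv.coe_fn_mk, vertexWeight_swap]
    exact if_neg hcon
  funext e
  obtain ⟨j, i, v⟩ := e
  fin_cases j <;> fin_cases i <;> simp [gridConfig, ofGridConfig, hpass]

theorem sum_gridConfig (K : KagomeWeights T) (F : (Fin 2 × (Fin 4 × T.Vertex) → Bool) → ℂ) :
    ∑ ρ, F ρ * B.grid.weight K.gridMatrix ρ
      = ∑ σ, F (gridConfig σ) * K.vertexProduct σ := by
  refine (Fintype.sum_of_injective gridConfig ?_ _ _ ?_ ?_).symm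
  · exact Function.LeftInverse.injective ofGridConfig_gridConfig
  · intro ρ hρ
    by_contra hne
    exact hρ ⟨_, gridConfig_ofGridConfig B K (right_ne_zero_of_mul hne)⟩
  · intro σ
    rw [weight_gridConfig]

/-- The number of horizontal and oblique external edges that carry arrows: the total displacement
to the right along the arrows. -/
noncomputable def displacementX (σ : KagomeEdge T → Bool) : ℕ :=
  ∑ v : T.Vertex, ((σ (.inl (.horizontal, v))).toNat + (σ (.inl (.oblique, v))).toNat)

/-- The number of oblique and vertical external edges that carry arrows: the total displacement
upwards along the arrows. -/
noncomputable def displacementY (σ : KagomeEdge T → Bool) : ℕ :=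
  ∑ v : T.Vertex, ((σ (.inl (.oblique, v))).toNat + (σ (.inl (.vertical, v))).toNat)

variable {B}

theorem sum_internal_eq_displacementX {σ : KagomeEdge T → Bool}
    (hσ : B.grid.IsBalanced (gridConfig σ)) :
    ∑ v : T.Vertex, ((σ (.inr (.horizontal, v))).toNat + (σ (.inr (.oblique, v))).toNat)
      = displacementX σ := by
  have h : ∀ v, (σ (.inr (.horizontal, v))).toNat + (σ (.inr (.oblique, v))).toNat
      = (σ (.inl (.horizontal, T.next .horizontal v))).toNat
        + (σ (.inl (.oblique, T.next .oblique v))).toNat := by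
    intro v
    have := hσ (1, v)
    simpa [SliceBasis.grid, SliceBasis.stepRight, SliceBasis.stepUp, gridConfig,
      T.next_vertical_horizontal] using this
  simp_rw [h]
  rw [displacementX, Finset.sum_add_distrib, Finset.sum_add_distrib]
  congr 1
  · exact Equiv.sum_comp (T.nextEquiv .horizontal) fun v => (σ (.inl (.horizontal, v))).toNat
  · exact Equiv.sum_comp (T.nextEquiv .oblique) fun v => (σ (.inl (.oblique, v))).toNat

theorem sum_internal_eq_displacementY {σ : KagomeEdge T → Bool}
    (hσ : B.grid.IsBalanced (gridConfig σ)) :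
    ∑ v : T.Vertex, ((σ (.inr (.oblique, v))).toNat + (σ (.inr (.vertical, v))).toNat)
      = displacementY σ := by
  refine Finset.sum_congr rfl fun v _ => ?_
  have := hσ (3, v)
  simpa [SliceBasis.grid, SliceBasis.stepRight, SliceBasis.stepUp, gridConfig] using this.symm

theorem card_gridConfig {σ : KagomeEdge T → Bool} (hσ : B.grid.IsBalanced (gridConfig σ)) :
    Fintype.card {e // gridConfig σ e = true} = 2 * (displacementX σ + displacementY σ) ∧
    ∑ w, (gridConfig σ (0, w)).toNat = 2 * displacementX σ := by
  have hx := sum_internal_eq_displacementX hσ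
  have hy := sum_internal_eq_displacementY hσ
  have hcard : Fintype.card {e // gridConfig σ e = true}
      = ∑ e, (gridConfig σ e).toNat := by
    rw [Fintype.card_subtype, Finset.card_filter]
    refine Finset.sum_congr rfl fun e _ => ?_
    cases gridConfig σ e <;> rfl
  have hshift : ∑ v : T.Vertex, (σ (.inl (.oblique, T.next .horizontal v))).toNat
      = ∑ v : T.Vertex, (σ (.inl (.oblique, v))).toNat :=
    Equiv.sum_comp (T.nextEquiv .horizontal) fun v => (σ (.inl (.oblique, v))).toNat
  rw [displacementX, displacementY] at *
  rw [hcard, Fintype.sum_prod_type, Fin.sum_univ_two, Fintype.sum_prod_type,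
    Fintype.sum_prod_type, Fin.sum_univ_four, Fin.sum_univ_four]
  simp only [gridConfig, Finset.sum_add_distrib] at *
  constructor <;> omega

theorem sum_Ico_two_mul (n : ℕ) (f : ℤ → ℤ) :
    ∑ τ ∈ Finset.Ico (0 : ℤ) (2 * n), f τ
      = ∑ t ∈ Finset.Ico (0 : ℤ) n, (f (2 * t) + f (2 * t + 1)) := by
  induction n with
  | zero => simp
  | succ n ih =>
    have h1 : Finset.Ico (0 : ℤ) (2 * (n + 1 : ℕ))
        = insert (2 * (n : ℤ) + 1) (insert (2 * (n : ℤ)) (Finset.Ico 0 (2 * (n : ℤ)))) := by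
      ext x
      simp only [Finset.mem_Ico, Finset.mem_insert]
      push_cast
      omega
    have h2 : Finset.Ico (0 : ℤ) (n + 1 : ℕ) = insert (n : ℤ) (Finset.Ico 0 (n : ℤ)) := by
      ext x
      simp only [Finset.mem_Ico, Finset.mem_insert]
      push_cast
      omega
    rw [h1, h2, Finset.sum_insert (by simp), Finset.sum_insert (by simp),
      Finset.sum_insert (by simp), ih]
    ring

theorem sum_grid_shift :
    ∑ τ ∈ Finset.Ico 0 B.grid.period, B.grid.shift τ = -2 * B.drift := by
  obtain ⟨n, hn⟩ := Int.eq_ofNat_of_zero_le B.period_pos.le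
  have hp := B.period_pos
  change ∑ τ ∈ Finset.Ico 0 (2 * B.period),
    (if τ % 2 = 0 then -1 else 1 + 2 * B.shift (τ / 2)) = -2 * B.drift
  have hd : ∀ t : ℤ, (2 * t + 1) / 2 = t := fun t => by omega
  have hm : ∀ t : ℤ, (2 * t + 1) % 2 = 1 := fun t => by omega
  have hs : ∀ t, -1 + (1 + 2 * B.shift t) = 2 * if t = B.period - 1 then -B.drift else 0 := by
    intro t
    rw [SliceBasis.shift]
    by_cases h : t + 1 = B.period
    · rw [if_pos h, if_pos (by omega)]; ring
    · rw [if_neg h, if_neg (by omega)]; ring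
  have hsum := sum_Ico_two_mul n fun τ => if τ % 2 = 0 then -1 else 1 + 2 * B.shift (τ / 2)
  rw [← hn] at hsum
  rw [hsum]
  simp only [Int.mul_emod_right, if_true, hd, hm, one_ne_zero, if_false, hs]
  rw [← Finset.mul_sum, Finset.sum_ite_eq', if_pos (Finset.mem_Ico.mpr ⟨by omega, by omega⟩)]
  ring

theorem negOnePow_eq_one_iff_even_and_even (m n : ℤ) :
    (m + n + m * n).negOnePow = 1 ↔ Even m ∧ Even n := by
  rw [Int.negOnePow_eq_one_iff]
  simp only [Int.even_add, Int.even_mul]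
  tauto

/-- The sign with which a configuration enters the determinant: it is determined by the homology
class `(m, n)` of the configuration, and it is `1` exactly for the classes divisible by two. -/
theorem exists_homology_class (B : SliceBasis T) {σ : KagomeEdge T → Bool}
    (hσ : B.grid.IsBalanced (gridConfig σ)) : ∃ m n : ℤ,
    (displacementX σ : ℤ) = m * T.a.1 + n * T.b.1 ∧
    (displacementY σ : ℤ) = m * T.a.2 + n * T.b.2 ∧
    (Fintype.card {e // gridConfig σ e = true} : ℤ).negOnePow * (B.grid.flow hσ).sign
      = (m + n + m * n).negOnePow := by
  obtain ⟨hc, hl⟩ := card_gridConfig hσ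
  have h1 := B.grid.card_arrows hσ
  have h2 := B.grid.width_mul_winding hσ
  rw [sum_grid_shift, ← Nat.cast_sum, hl] at h2
  rw [hc] at h1
  rw [B.grid.sign_flow hσ]
  generalize (B.grid.sliceCard (gridConfig σ) 0 : ℤ) = N at *
  generalize B.grid.winding (gridConfig σ) = R at *
  have h1' : (displacementX σ : ℤ) + displacementY σ = B.period * N := by
    have : B.grid.period = 2 * B.period := rfl
    rw [this] at h1
    push_cast at h1
    linarith
  have h2' : (displacementX σ : ℤ) = B.drift * N + B.width * R := by
    have : B.grid.width = 2 * B.width := rfl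
    rw [this] at h2
    push_cast at h2
    linarith
  obtain ⟨m, n, hm, hn⟩ := (mem_periods_iff T _ _).mp ((B.mem_iff _ _).mpr ⟨N, R, h1', h2'⟩)
  refine ⟨m, n, hm, hn, ?_⟩
  have key : (Even N ∧ Even R) ↔ (Even m ∧ Even n) := by
    constructor
    · rintro ⟨⟨N', rfl⟩, ⟨R', rfl⟩⟩
      obtain ⟨m', n', hm', hn'⟩ := (mem_periods_iff T _ _).mp
        ((B.mem_iff (B.drift * N' + B.width * R')
          (B.period * N' - (B.drift * N' + B.width * R'))).mpr ⟨N', R', by ring, rfl⟩)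
      have e1 : (m - (m' + m')) * T.a.1 + (n - (n' + n')) * T.b.1 = 0 := by
        linear_combination h2' - hm - 2 * (-hm')
      have e2 : (m - (m' + m')) * T.a.2 + (n - (n' + n')) * T.b.2 = 0 := by
        linear_combination h1' - h2' - hn + 2 * hn'
      have e3 : (m - (m' + m')) * (T.a.1 * T.b.2 - T.a.2 * T.b.1) = 0 := by
        linear_combination T.b.2 * e1 - T.b.1 * e2
      have e4 : (n - (n' + n')) * (T.a.1 * T.b.2 - T.a.2 * T.b.1) = 0 := by
        linear_combination T.a.1 * e2 - T.a.2 * e1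
      have e5 := (mul_eq_zero.mp e3).resolve_right T.indep
      have e6 := (mul_eq_zero.mp e4).resolve_right T.indep
      exact ⟨⟨m', by linarith⟩, ⟨n', by linarith⟩⟩
    · rintro ⟨⟨m', rfl⟩, ⟨n', rfl⟩⟩
      obtain ⟨N', R', hN', hR'⟩ := (B.mem_iff _ _).mp ((mem_periods_iff T
        (m' * T.a.1 + n' * T.b.1) (m' * T.a.2 + n' * T.b.2)).mpr ⟨m', n', rfl, rfl⟩)
      have e1 : B.period * (N - (N' + N')) = 0 := by
        linear_combination hm + hn - h1' + 2 * hN'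
      have e2 := (mul_eq_zero.mp e1).resolve_left B.period_pos.ne'
      have e3 : B.width * (R - (R' + R')) = 0 := by
        linear_combination hm - h2' + 2 * hR' - B.drift * e2
      have e4 := (mul_eq_zero.mp e3).resolve_left B.width_pos.ne'
      exact ⟨⟨N', by linarith⟩, ⟨R', by linarith⟩⟩
  have h3 := negOnePow_eq_one_iff_even_and_even N R
  have h4 := negOnePow_eq_one_iff_even_and_even m n
  rcases Int.units_eq_one_or (N + R + N * R).negOnePow with h | h <;>
    rcases Int.units_eq_one_or (m + n + m * n).negOnePow with h' | h'
  · rw [h, h']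
  · exact absurd (h4.mpr (key.mp (h3.mp h))) (by rw [h']; decide)
  · exact absurd (h3.mpr (key.mpr (h4.mp h'))) (by rw [h]; decide)
  · rw [h, h']

end KagomeWeights

/-! ### Elimination of the edges of one kind -/

/-- The relations between the blocks of `A₁ = a + v`, `A₂ = b + o`, `A₃ = c + h`, where `h`, `o`, `v`
are the projections to three complementary blocks. -/
structure IsSplit {R : Type*} [Ring R] (h o v a b c : R) : Prop where
  sum_eq : h + o + v = 1
  ho : h * o = 0
  oh : o * h = 0
  hv : h * v = 0
  vh : v * h = 0
  ov : o * v = 0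
  vo : v * o = 0
  av : a * v = 0
  va : v * a = 0
  bo : b * o = 0
  ob : o * b = 0
  ch : c * h = 0
  hc : h * c = 0

namespace IsSplit

variable {R : Type*} [Ring R] {h o v a b c : R}

theorem reverse (H : IsSplit h o v a b c) : IsSplit v o h c b a where
  sum_eq := by rw [← H.sum_eq]; abel
  ho := H.vo
  oh := H.ov
  hv := H.vh
  vh := H.hv
  ov := H.oh
  vo := H.ho
  av := H.ch
  va := H.hc
  bo := H.bo
  ob := H.ob
  ch := H.av
  hc := H.va

theorem mul_insert (H : IsSplit h o v a b c) (x y : R) :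
    x * y = x * (h * y) + x * (o * y) + x * (v * y) := by
  rw [← mul_add, ← mul_add, ← add_mul, ← add_mul, H.sum_eq, one_mul]

theorem product_eq (H : IsSplit h o v a b c) :
    v * b * h + (a + v * b * v) * (1 + h * b * v) * (h * b * h + c)
      = (a + v) * (b + o) * (c + h) := by
  have zero : ∀ {x y : R}, x * y = 0 → ∀ z, x * (y * z) = 0 := by
    intro x y hxy z
    rw [← mul_assoc, hxy, zero_mul]
  have hab : ∀ z, a * (b * z) = a * (h * (b * z)) := fun z => by
    rw [H.mul_insert a (b * z), zero H.ob, zero H.av]; simp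
  have hbc : b * c = b * (v * c) := by
    rw [H.mul_insert b c, H.hc, zero H.bo]; simp
  have hac : a * c = a * (o * c) := by
    rw [H.mul_insert a c, H.hc, zero H.av]; simp
  simp only [mul_add, add_mul, mul_assoc, mul_one]
  rw [hab, hab, hbc, hac]
  simp only [zero H.vh, H.oh, zero H.vo, mul_zero, add_zero]
  abel

end IsSplit

section Determinant

open Matrix

variable {X : Type*} [Fintype X] [DecidableEq X] {h o v a b c : Matrix X X ℂ}

theorem det_fromBlocks_of_isSplit (H : IsSplit h o v a b c) :
    (fromBlocks (1 - v * b * h) (-(a + v * b * v)) (-(h * b * h + c)) (1 - h * b * v)).det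
      = (1 - (a + v) * (b + o) * (c + h)).det := by
  have hN : h * b * v * (h * b * v) = 0 := by
    rw [show h * b * v * (h * b * v) = h * b * (v * h) * (b * v) by simp only [mul_assoc], H.vh,
      mul_zero, zero_mul]
  let _ : Invertible (1 - h * b * v) :=
    ⟨1 + h * b * v, by rw [add_mul, mul_sub, mul_sub, hN]; simp,
      by rw [mul_add, sub_mul, sub_mul, hN]; simp⟩
  have hdet : (1 - h * b * v).det = 1 := by
    rw [det_one_sub_mul_comm, ← mul_assoc, H.vh, zero_mul, sub_zero, det_one]
  rw [det_fromBlocks₂₂, hdet, one_mul]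
  congr 1
  change _ - -(a + v * b * v) * (1 + h * b * v) * -(h * b * h + c) = _
  rw [← H.product_eq]
  simp only [neg_mul, mul_neg, neg_neg]
  abel

/-- The order of the three factors may be reversed under the determinant: both determinants result
from the same matrix of double size, by elimination of one or the other half of the indices. -/
theorem det_one_sub_reverse (H : IsSplit h o v a b c) :
    (1 - (a + v) * (b + o) * (c + h)).det = (1 - (c + h) * (b + o) * (a + v)).det := by
  rw [← det_fromBlocks_of_isSplit H, ← det_fromBlocks_of_isSplit H.reverse,
    ← det_submatrix_equiv_self (Equiv.sumComm X X), add_comm a, add_comm c]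
  congr 1
  ext i j
  cases i <;> cases j <;> rfl

end Determinant

namespace TorusLattice

variable (T : TorusLattice)

/-- The projection to the block `d`. -/
noncomputable def blockProj (d : Direction) : T.EdgeMatrix :=
  Matrix.diagonal fun e => if e.1 = d then 1 else 0

theorem blockProj_mul_blockProj {d d' : Direction} (h : d ≠ d') :
    T.blockProj d * T.blockProj d' = 0 := by
  rw [blockProj, blockProj, Matrix.diagonal_mul_diagonal, ← Matrix.diagonal_zero]
  congr 1
  funext e
  by_cases he : e.1 = d
  · rw [if_neg (fun h' => h (he.symm.trans h')), mul_zero]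
  · rw [if_neg he, zero_mul]

theorem blockProj_mul_self (d : Direction) : T.blockProj d * T.blockProj d = T.blockProj d := by
  rw [blockProj, Matrix.diagonal_mul_diagonal]
  congr 1
  funext e
  split_ifs <;> simp

theorem sum_blockProj :
    T.blockProj .horizontal + T.blockProj .oblique + T.blockProj .vertical = 1 := by
  rw [blockProj, blockProj, blockProj, Matrix.diagonal_add, Matrix.diagonal_add,
    ← Matrix.diagonal_one]
  congr 1
  funext ⟨d, v⟩
  cases d <;> simp

variable {T}

theorem IsTrivialOn.mul_blockProj {d : Direction} {M : T.EdgeMatrix} (h : T.IsTrivialOn d M) :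
    M * T.blockProj d = T.blockProj d := by
  ext e' e
  rw [blockProj, Matrix.mul_diagonal, Matrix.diagonal_apply]
  by_cases he : e.1 = d
  · rw [h e e' (Or.inl he), Matrix.one_apply, if_pos he, mul_one]
    by_cases hee : e' = e
    · rw [if_pos hee, if_pos hee, hee, if_pos he]
    · rw [if_neg hee, if_neg hee]
  · rw [if_neg he, mul_zero]
    by_cases hee : e' = e
    · rw [if_pos hee, hee, if_neg he]
    · rw [if_neg hee]

theorem IsTrivialOn.blockProj_mul {d : Direction} {M : T.EdgeMatrix} (h : T.IsTrivialOn d M) :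
    T.blockProj d * M = T.blockProj d := by
  ext e' e
  rw [blockProj, Matrix.diagonal_mul, Matrix.diagonal_apply]
  by_cases he : e'.1 = d
  · rw [h e e' (Or.inr he), Matrix.one_apply, if_pos he, one_mul]
  · rw [if_neg he, zero_mul, ite_self]

theorem isSplit {A₁ A₂ A₃ : T.EdgeMatrix} (h₁ : T.IsTrivialOn .vertical A₁)
    (h₂ : T.IsTrivialOn .oblique A₂) (h₃ : T.IsTrivialOn .horizontal A₃) :
    IsSplit (T.blockProj .horizontal) (T.blockProj .oblique) (T.blockProj .vertical)
      (A₁ - T.blockProj .vertical) (A₂ - T.blockProj .oblique)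
      (A₃ - T.blockProj .horizontal) where
  sum_eq := T.sum_blockProj
  ho := T.blockProj_mul_blockProj (by simp)
  oh := T.blockProj_mul_blockProj (by simp)
  hv := T.blockProj_mul_blockProj (by simp)
  vh := T.blockProj_mul_blockProj (by simp)
  ov := T.blockProj_mul_blockProj (by simp)
  vo := T.blockProj_mul_blockProj (by simp)
  av := by rw [sub_mul, h₁.mul_blockProj, blockProj_mul_self, sub_self]
  va := by rw [mul_sub, h₁.blockProj_mul, blockProj_mul_self, sub_self]
  bo := by rw [sub_mul, h₂.mul_blockProj, blockProj_mul_self, sub_self]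
  ob := by rw [mul_sub, h₂.blockProj_mul, blockProj_mul_self, sub_self]
  ch := by rw [sub_mul, h₃.mul_blockProj, blockProj_mul_self, sub_self]
  hc := by rw [mul_sub, h₃.blockProj_mul, blockProj_mul_self, sub_self]

theorem det_one_sub_reverse {A₁ A₂ A₃ : T.EdgeMatrix} (h₁ : T.IsTrivialOn .vertical A₁)
    (h₂ : T.IsTrivialOn .oblique A₂) (h₃ : T.IsTrivialOn .horizontal A₃) :
    (1 - A₁ * A₂ * A₃).det = (1 - A₃ * A₂ * A₁).det := by
  simpa using _root_.det_one_sub_reverse (isSplit h₁ h₂ h₃)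

end TorusLattice

namespace KagomeWeights

variable {T : TorusLattice} (K : KagomeWeights T)

theorem isTrivialOn_factor₁ : T.IsTrivialOn .vertical K.factor₁ := by
  rintro ⟨d, v⟩ ⟨d', v'⟩ h
  cases d <;> cases d' <;> simp_all [factor₁, Matrix.one_apply]

theorem isTrivialOn_factor₂ : T.IsTrivialOn .oblique K.factor₂ := by
  rintro ⟨d, v⟩ ⟨d', v'⟩ h
  cases d <;> cases d' <;> simp_all [factor₂, Matrix.one_apply]

theorem isTrivialOn_factor₃ : T.IsTrivialOn .horizontal K.factor₃ := by
  rintro ⟨d, v⟩ ⟨d', v'⟩ h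
  cases d <;> cases d' <;> simp_all [factor₃, Matrix.one_apply]

/-- The edges of the square lattice: those of the kagome lattice, and for every passing point the
first halves of the internal and of the external oblique edge. -/
def gridEdgeEquiv (T : TorusLattice) :
    Fin 2 × (Fin 4 × T.Vertex) ≃ KagomeEdge T ⊕ (Fin 2 × T.Vertex) where
  toFun
    | (0, (0, v)) => .inr (0, v)
    | (1, (0, v)) => .inr (1, v)
    | (0, (1, v)) => .inl (.inr (.horizontal, v))
    | (1, (1, v)) => .inl (.inr (.oblique, v))
    | (0, (2, v)) => .inl (.inl (.horizontal, v))
    | (1, (2, v)) => .inl (.inr (.vertical, v))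
    | (0, (3, v)) => .inl (.inl (.oblique, v))
    | (1, (3, v)) => .inl (.inl (.vertical, v))
  invFun
    | .inr (0, v) => (0, (0, v))
    | .inr (1, v) => (1, (0, v))
    | .inl (.inr (.horizontal, v)) => (0, (1, v))
    | .inl (.inr (.oblique, v)) => (1, (1, v))
    | .inl (.inl (.horizontal, v)) => (0, (2, v))
    | .inl (.inr (.vertical, v)) => (1, (2, v))
    | .inl (.inl (.oblique, v)) => (0, (3, v))
    | .inl (.inl (.vertical, v)) => (1, (3, v))
  left_inv := by
    rintro ⟨j, i, v⟩
    fin_cases j <;> fin_cases i <;> rfl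
  right_inv := by
    rintro ((⟨d, v⟩ | ⟨d, v⟩) | ⟨j, v⟩)
    · cases d <;> rfl
    · cases d <;> rfl
    · fin_cases j <;> rfl

/-- The determinant for the square lattice is the one for the kagome lattice: elimination of the first
halves of the oblique edges, and then of the internal edges, leaves the product of the three
factors. -/
theorem det_grid (B : SliceBasis T) : (1 - B.grid.stepMatrix K.gridMatrix).det
    = (1 - K.factor₁ * K.factor₂ * K.factor₃).det := by
  have hsplit := det_fromBlocks_of_isSplit (TorusLattice.isSplit K.isTrivialOn_factor₁
    K.isTrivialOn_factor₂ K.isTrivialOn_factor₃)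
  simp only [sub_add_cancel] at hsplit
  let A : Matrix (KagomeEdge T ⊕ (Fin 2 × T.Vertex)) (KagomeEdge T ⊕ (Fin 2 × T.Vertex)) ℂ :=
    (B.grid.stepMatrix K.gridMatrix).submatrix (gridEdgeEquiv T).symm (gridEdgeEquiv T).symm
  have hA : (1 - B.grid.stepMatrix K.gridMatrix).det = (1 - A).det := by
    rw [← Matrix.det_submatrix_equiv_self (gridEdgeEquiv T).symm, Matrix.submatrix_sub]
    simp [A]
  have h22 : A.toBlocks₂₂ = 0 := by
    ext ⟨j', v'⟩ ⟨j, v⟩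
    fin_cases j' <;> fin_cases j <;>
      simp [A, Matrix.toBlocks₂₂, gridEdgeEquiv, SquareTorus.stepMatrix, SliceBasis.grid,
        SliceBasis.stepRight, SliceBasis.stepUp]
  have h11 : A.toBlocks₁₁ + A.toBlocks₁₂ * A.toBlocks₂₁ = Matrix.fromBlocks
      (T.blockProj .vertical * (K.factor₂ - T.blockProj .oblique) * T.blockProj .horizontal)
      (K.factor₁ - T.blockProj .vertical
        + T.blockProj .vertical * (K.factor₂ - T.blockProj .oblique) * T.blockProj .vertical)
      (T.blockProj .horizontal * (K.factor₂ - T.blockProj .oblique) * T.blockProj .horizontal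
        + (K.factor₃ - T.blockProj .horizontal))
      (T.blockProj .horizontal * (K.factor₂ - T.blockProj .oblique)
        * T.blockProj .vertical) := by
    ext e' e
    rw [Matrix.add_apply, Matrix.mul_apply, Fintype.sum_prod_type, Fin.sum_univ_two]
    rcases e' with ⟨d', v'⟩ | ⟨d', v'⟩ <;> rcases e with ⟨d, v⟩ | ⟨d, v⟩ <;>
      cases d' <;> cases d <;>
      simp [A, Matrix.toBlocks₁₁, Matrix.toBlocks₁₂, Matrix.toBlocks₂₁, gridEdgeEquiv,
        SquareTorus.stepMatrix, SliceBasis.grid, SliceBasis.stepRight, SliceBasis.stepUp,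
        TorusLattice.blockProj, Matrix.diagonal_mul, Matrix.mul_diagonal, Matrix.diagonal_apply,
        factor₁, factor₂, factor₃, gridMatrix, T.next_vertical_horizontal]
  have hblocks : 1 - A = Matrix.fromBlocks (1 - A.toBlocks₁₁) (-A.toBlocks₁₂) (-A.toBlocks₂₁) 1 := by
    conv_lhs => rw [← Matrix.fromBlocks_toBlocks A, h22, ← Matrix.fromBlocks_one]
    rw [sub_eq_add_neg, Matrix.fromBlocks_neg, Matrix.fromBlocks_add]
    simp [sub_eq_add_neg]
  rw [← hsplit, hA, hblocks, Matrix.det_fromBlocks_one₂₂, Matrix.neg_mul, Matrix.mul_neg, neg_neg,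
    sub_sub, h11, ← Matrix.fromBlocks_one, sub_eq_add_neg, Matrix.fromBlocks_neg,
    Matrix.fromBlocks_add]
  simp [sub_eq_add_neg]

end KagomeWeights

/-! ### Edge weights and the spectral parameters -/

namespace TorusLattice

variable {T : TorusLattice}

theorem blockScalar_mul_blockScalar (u v w u' v' w' : ℂ) :
    T.blockScalar u v w * T.blockScalar u' v' w' = T.blockScalar (u * u') (v * v') (w * w') := by
  rw [blockScalar, blockScalar, blockScalar, Matrix.diagonal_mul_diagonal]
  congr 1
  funext ⟨d, v⟩
  cases d <;> rfl

theorem blockScalar_one : T.blockScalar 1 1 1 = 1 := by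
  rw [blockScalar, ← Matrix.diagonal_one]
  congr 1
  funext ⟨d, v⟩
  cases d <;> rfl

theorem IsTrivialOn.commute_diagonal {d : Direction} {M : T.EdgeMatrix} (h : T.IsTrivialOn d M)
    {D : T.Edge → ℂ} (hD : ∀ e e', e.1 ≠ d → e'.1 ≠ d → D e = D e') :
    Matrix.diagonal D * M = M * Matrix.diagonal D := by
  ext e' e
  rw [Matrix.diagonal_mul, Matrix.mul_diagonal, mul_comm]
  by_cases he : e.1 = d ∨ e'.1 = d
  · rw [h e e' he, Matrix.one_apply]
    by_cases hee : e' = e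
    · rw [hee]
    · rw [if_neg hee, zero_mul, zero_mul]
  · rw [not_or] at he
    rw [hD e e' he.1 he.2]

theorem IsTrivialOn.mul {d : Direction} {M N : T.EdgeMatrix} (hM : T.IsTrivialOn d M)
    (hN : T.IsTrivialOn d N) : T.IsTrivialOn d (M * N) := by
  intro e e' h
  rw [Matrix.mul_apply]
  rcases h with h | h
  · have h1 : ∀ x, M e' x * N x e = M e' x * (1 : T.EdgeMatrix) x e := fun x => by
      rw [hN e x (Or.inl h)]
    simp_rw [h1]
    rw [← Matrix.mul_apply, mul_one, hM e e' (Or.inl h)]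
  · have h1 : ∀ x, M e' x * N x e = (1 : T.EdgeMatrix) e' x * N x e := fun x => by
      rw [hM x e' (Or.inr h)]
    simp_rw [h1]
    rw [← Matrix.mul_apply, one_mul, hN e e' (Or.inr h)]

theorem isTrivialOn_blockScalar_vertical (u v : ℂ) :
    T.IsTrivialOn .vertical (T.blockScalar u v 1) := by
  rintro ⟨d, x⟩ ⟨d', x'⟩ h
  cases d <;> cases d' <;> simp_all [blockScalar, Matrix.diagonal_apply, Matrix.one_apply]

theorem isTrivialOn_blockScalar_horizontal (v w : ℂ) :
    T.IsTrivialOn .horizontal (T.blockScalar 1 v w) := by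
  rintro ⟨d, x⟩ ⟨d', x'⟩ h
  cases d <;> cases d' <;> simp_all [blockScalar, Matrix.diagonal_apply, Matrix.one_apply]

/-- As `Λ = diag(u, uw, w)` is a product of two block-scalar matrices, the first of which commutes
with `A₁` and the second with `A₃`, the spectral parameters can be absorbed into these factors. -/
theorem integralOfMotion_mul {A₁ A₃ : T.EdgeMatrix} (A₂ : T.EdgeMatrix)
    (h₁ : T.IsTrivialOn .vertical A₁) (h₃ : T.IsTrivialOn .horizontal A₃) (u w : ℂˣ) :
    T.integralOfMotion (A₁ * A₂ * A₃) u w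
      = (1 - A₁ * T.blockScalar (u : ℂ)⁻¹ (u : ℂ)⁻¹ 1 * A₂
          * (T.blockScalar 1 (w : ℂ)⁻¹ (w : ℂ)⁻¹ * A₃)).det := by
  have hU : T.blockScalar (u : ℂ)⁻¹ (u : ℂ)⁻¹ 1 * A₁ = A₁ * T.blockScalar (u : ℂ)⁻¹ (u : ℂ)⁻¹ 1 :=
    h₁.commute_diagonal <| by
      rintro ⟨d, x⟩ ⟨d', x'⟩ h h'
      cases d <;> cases d' <;> simp_all
  have hW : T.blockScalar 1 (w : ℂ)⁻¹ (w : ℂ)⁻¹ * A₃ = A₃ * T.blockScalar 1 (w : ℂ)⁻¹ (w : ℂ)⁻¹ :=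
    h₃.commute_diagonal <| by
      rintro ⟨d, x⟩ ⟨d', x'⟩ h h'
      cases d <;> cases d' <;> simp_all
  have hUW : T.blockScalar (u : ℂ)⁻¹ ((u : ℂ)⁻¹ * (w : ℂ)⁻¹) (w : ℂ)⁻¹
      = T.blockScalar 1 (w : ℂ)⁻¹ (w : ℂ)⁻¹ * T.blockScalar (u : ℂ)⁻¹ (u : ℂ)⁻¹ 1 := by
    rw [blockScalar_mul_blockScalar, one_mul, mul_one, mul_comm (w : ℂ)⁻¹]
  rw [integralOfMotion, hUW, ← mul_assoc, Matrix.det_one_sub_mul_comm, ← hU, hW]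
  simp only [mul_assoc]

/-- The determinant does not change when the order of the factors is reversed. -/
theorem integralOfMotion_reverse {A₁ A₂ A₃ : T.EdgeMatrix} (h₁ : T.IsTrivialOn .vertical A₁)
    (h₂ : T.IsTrivialOn .oblique A₂) (h₃ : T.IsTrivialOn .horizontal A₃) (u w : ℂˣ) :
    T.integralOfMotion (A₃ * A₂ * A₁) u w = T.integralOfMotion (A₁ * A₂ * A₃) u w := by
  rw [T.integralOfMotion_mul A₂ h₁ h₃, det_one_sub_reverse
    (h₁.mul (isTrivialOn_blockScalar_vertical _ _)) h₂
    ((isTrivialOn_blockScalar_horizontal _ _).mul h₃)]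
  have hUW : T.blockScalar (u : ℂ)⁻¹ ((u : ℂ)⁻¹ * (w : ℂ)⁻¹) (w : ℂ)⁻¹
      = T.blockScalar (u : ℂ)⁻¹ (u : ℂ)⁻¹ 1 * T.blockScalar 1 (w : ℂ)⁻¹ (w : ℂ)⁻¹ := by
    rw [blockScalar_mul_blockScalar, one_mul, mul_one]
  rw [integralOfMotion, hUW, ← mul_assoc, Matrix.det_one_sub_mul_comm]
  simp only [mul_assoc]

theorem integralOfMotion_of_gaugeEquivalent {A A' : T.EdgeMatrix} (h : T.GaugeEquivalent A A')
    (u w : ℂˣ) : T.integralOfMotion A' u w = T.integralOfMotion A u w := by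
  obtain ⟨G, hG, rfl⟩ := h
  have hcomm : ∀ x y z : ℂ, (G : T.EdgeMatrix) * T.blockScalar x y z
      = T.blockScalar x y z * (G : T.EdgeMatrix) := by
    intro x y z
    ext ⟨d', v'⟩ ⟨d, v⟩
    rw [blockScalar, Matrix.diagonal_mul, Matrix.mul_diagonal, mul_comm]
    by_cases hd : d = d'
    · rw [hd]
    · rw [hG _ _ hd, mul_zero, mul_zero]
  rw [integralOfMotion, integralOfMotion, mul_assoc, mul_assoc, hcomm,
    Matrix.det_one_sub_mul_comm, mul_assoc, mul_assoc, Units.mul_inv, mul_one]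

theorem integralOfMotion_of_evolvesIn {k : ℕ} {A A' : T.EdgeMatrix} (h : T.EvolvesIn k A A')
    (u w : ℂˣ) : T.integralOfMotion A' u w = T.integralOfMotion A u w := by
  induction h with
  | zero A A' h => exact integralOfMotion_of_gaugeEquivalent h u w
  | succ k A A' A'' _ h ih =>
    obtain ⟨A₁, A₂, A₃, h₁, h₂, h₃, rfl, hg⟩ := h
    rw [integralOfMotion_of_gaugeEquivalent hg, integralOfMotion_reverse h₁ h₂ h₃, ih]

theorem integralOfMotion_eq_zero_iff (A : T.EdgeMatrix) (u w : ℂˣ) :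
    T.integralOfMotion A u w = 0 ↔
      ((u : ℂ), (u : ℂ) * (w : ℂ), (w : ℂ)) ∈ T.invariantCurve A := by
  have hinv : T.blockScalar (u : ℂ)⁻¹ ((u : ℂ)⁻¹ * (w : ℂ)⁻¹) (w : ℂ)⁻¹
      * T.blockScalar u (u * w) w = 1 := by
    rw [blockScalar_mul_blockScalar, ← blockScalar_one]
    congr 1 <;> field_simp
  have hdet : (T.blockScalar (u : ℂ) (u * w) w).det ≠ 0 := by
    intro h0
    have := congrArg Matrix.det hinv
    rw [Matrix.det_mul, h0, mul_zero, Matrix.det_one] at this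
    exact zero_ne_one this
  have hA : A - T.blockScalar (u : ℂ) (u * w) w
      = -(1 - A * T.blockScalar (u : ℂ)⁻¹ ((u : ℂ)⁻¹ * (w : ℂ)⁻¹) (w : ℂ)⁻¹)
        * T.blockScalar u (u * w) w := by
    rw [neg_mul, sub_mul, mul_assoc, hinv]
    simp
  simp only [invariantCurve, Set.mem_ofPred_eq, and_true]
  rw [hA, Matrix.det_mul, Matrix.det_neg, integralOfMotion]
  simp [hdet]

/-- Every pair of non-zero numbers consists of the weights of the basis cycles for suitable `u`,
`w`. -/
theorem exists_cycle_eq (T : TorusLattice) (x y : ℂˣ) :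
    ∃ u w : ℂˣ, T.cycleX u w = x ∧ T.cycleY u w = y := by
  have root : ∀ z : ℂˣ, ∃ r : ℂˣ, r ^ (T.a.1 * T.b.2 - T.a.2 * T.b.1) = z := by
    intro z
    generalize hD : T.a.1 * T.b.2 - T.a.2 * T.b.1 = D
    have hD0 : D ≠ 0 := hD ▸ T.indep
    obtain ⟨r, hr⟩ := IsAlgClosed.exists_pow_nat_eq (z : ℂ) (Int.natAbs_pos.mpr hD0)
    have hr0 : r ≠ 0 := by
      rintro rfl
      rw [zero_pow (Int.natAbs_pos.mpr hD0).ne'] at hr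
      exact z.ne_zero hr.symm
    have hru : (Units.mk0 r hr0) ^ D.natAbs = z := Units.ext (by simpa using hr)
    rcases Int.natAbs_eq D with h | h
    · exact ⟨Units.mk0 r hr0, by rw [h, zpow_natCast]; exact hru⟩
    · exact ⟨(Units.mk0 r hr0)⁻¹, by rw [h, inv_zpow', neg_neg, zpow_natCast]; exact hru⟩
  obtain ⟨ξ, hξ⟩ := root x⁻¹
  obtain ⟨η, hη⟩ := root y⁻¹
  refine ⟨ξ ^ T.b.2 * η ^ (-T.a.2), ξ ^ (-T.b.1) * η ^ T.a.1, ?_, ?_⟩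
  · rw [cycleX, mul_zpow, mul_zpow, ← zpow_mul, ← zpow_mul, ← zpow_mul, ← zpow_mul,
      mul_mul_mul_comm, ← zpow_add, ← zpow_add,
      show T.b.2 * -T.a.1 + -T.b.1 * -T.a.2 = -(T.a.1 * T.b.2 - T.a.2 * T.b.1) by ring,
      show -T.a.2 * -T.a.1 + T.a.1 * -T.a.2 = 0 by ring, zpow_neg, hξ]
    simp
  · rw [cycleY, mul_zpow, mul_zpow, ← zpow_mul, ← zpow_mul, ← zpow_mul, ← zpow_mul,
      mul_mul_mul_comm, ← zpow_add, ← zpow_add,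
      show T.b.2 * -T.b.1 + -T.b.1 * -T.b.2 = 0 by ring,
      show -T.a.2 * -T.b.1 + T.a.1 * -T.b.2 = -(T.a.1 * T.b.2 - T.a.2 * T.b.1) by ring,
      zpow_neg, hη]
    simp

end TorusLattice

namespace KagomeWeights

variable {T : TorusLattice}

/-- The vertex matrices with the edge weights absorbed: `u⁻¹` at the vertices of type 1 and `w⁻¹`
at the vertices of type 3, which meet every path as often as it goes one step to the right or
upwards, respectively. -/
noncomputable def scale (K : KagomeWeights T) (u w : ℂˣ) : KagomeWeights T where
  M₁ v := (u : ℂ)⁻¹ • K.M₁ v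
  M₂ := K.M₂
  M₃ v := (w : ℂ)⁻¹ • K.M₃ v

theorem factor₁_scale (K : KagomeWeights T) (u w : ℂˣ) :
    (K.scale u w).factor₁ = K.factor₁ * T.blockScalar (u : ℂ)⁻¹ (u : ℂ)⁻¹ 1 := by
  ext ⟨d', v'⟩ ⟨d, v⟩
  rw [TorusLattice.blockScalar, Matrix.mul_diagonal]
  cases d' <;> cases d <;> simp [factor₁, scale, mul_comm]

theorem factor₃_scale (K : KagomeWeights T) (u w : ℂˣ) :
    (K.scale u w).factor₃ = T.blockScalar 1 (w : ℂ)⁻¹ (w : ℂ)⁻¹ * K.factor₃ := by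
  ext ⟨d', v'⟩ ⟨d, v⟩
  rw [TorusLattice.blockScalar, Matrix.diagonal_mul]
  cases d' <;> cases d <;> simp [factor₃, scale]

theorem factor₂_scale (K : KagomeWeights T) (u w : ℂˣ) :
    (K.scale u w).factor₂ = K.factor₂ := rfl

theorem integralOfMotion_eq_det (K : KagomeWeights T) (u w : ℂˣ) :
    T.integralOfMotion (K.factor₁ * K.factor₂ * K.factor₃) u w
      = (1 - (K.scale u w).factor₁ * (K.scale u w).factor₂ * (K.scale u w).factor₃).det := by
  rw [T.integralOfMotion_mul _ K.isTrivialOn_factor₁ K.isTrivialOn_factor₃, factor₁_scale,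
    factor₂_scale, factor₃_scale]

theorem vertexWeight_smul (c : ℂ) (M : Matrix (Fin 2) (Fin 2) ℂ) (i₀ i₁ o₀ o₁ : Bool) :
    vertexWeight (c • M) i₀ i₁ o₀ o₁
      = c ^ (i₀.toNat + i₁.toNat) * vertexWeight M i₀ i₁ o₀ o₁ := by
  cases i₀ <;> cases i₁ <;> cases o₀ <;> cases o₁ <;> simp [vertexWeight]
  ring

theorem vertexProduct_scale (K : KagomeWeights T) (u w : ℂˣ) (σ : KagomeEdge T → Bool) :
    (K.scale u w).vertexProduct σ = K.vertexProduct σ *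
      (((u : ℂ)⁻¹) ^ (∑ v : T.Vertex,
          ((σ (.inr (.horizontal, v))).toNat + (σ (.inr (.oblique, v))).toNat)) *
        ((w : ℂ)⁻¹) ^ displacementY σ) := by
  rw [displacementY, ← Finset.prod_pow_eq_pow_sum, ← Finset.prod_pow_eq_pow_sum, vertexProduct,
    vertexProduct, ← Finset.prod_mul_distrib, ← Finset.prod_mul_distrib]
  refine Finset.prod_congr rfl fun v _ => ?_
  simp only [scale, vertexWeight_smul]
  ring

theorem isBalanced_of_vertexProduct_ne_zero (B : SliceBasis T) {K : KagomeWeights T}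
    {σ : KagomeEdge T → Bool} (h : K.vertexProduct σ ≠ 0) :
    B.grid.IsBalanced (gridConfig σ) := by
  by_contra hcon
  rw [← weight_gridConfig B] at h
  exact h (B.grid.weight_eq_zero K.gridMatrix hcon)

theorem det_eq_sum (B : SliceBasis T) (K : KagomeWeights T) {m n : (KagomeEdge T → Bool) → ℤ}
    (hmn : ∀ σ, ∀ hσ : B.grid.IsBalanced (gridConfig σ),
      (Fintype.card {e // gridConfig σ e = true} : ℤ).negOnePow * (B.grid.flow hσ).sign
        = (m σ + n σ + m σ * n σ).negOnePow) :
    (1 - K.factor₁ * K.factor₂ * K.factor₃).det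
      = ∑ σ, (((m σ + n σ + m σ * n σ).negOnePow : ℤ) : ℂ) * K.vertexProduct σ := by
  classical
  have hterm : ∀ ρ, (((Fintype.card {e // ρ e = true} : ℤ).negOnePow : ℤ) : ℂ) *
        (minorMatrix (B.grid.stepMatrix K.gridMatrix) ρ).det
      = (if h : B.grid.IsBalanced ρ then
          ((((Fintype.card {e // ρ e = true} : ℤ).negOnePow * (B.grid.flow h).sign : ℤˣ) : ℤ) : ℂ)
          else 0) * B.grid.weight K.gridMatrix ρ := by
    intro ρ
    by_cases h : B.grid.IsBalanced ρ
    · rw [dif_pos h, B.grid.minor_eq_of_isBalanced _ h, Units.val_mul, Int.cast_mul, mul_assoc]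
    · rw [dif_neg h, B.grid.minor_eq_zero _ h, mul_zero, zero_mul]
  rw [← K.det_grid B, det_one_sub_eq_sum, Finset.sum_congr rfl fun ρ _ => hterm ρ,
    sum_gridConfig B K]
  refine Finset.sum_congr rfl fun σ _ => ?_
  by_cases h : K.vertexProduct σ = 0
  · rw [h, mul_zero, mul_zero]
  · have hb := isBalanced_of_vertexProduct_ne_zero B h
    rw [dif_pos hb, hmn σ hb]

/-- The product of the edge weights is determined by the displacement along the arrows. -/
theorem configWeight_eq (B : SliceBasis T) (K : KagomeWeights T) (p q : ℂ)
    (σ : KagomeEdge T → Bool) : K.configWeight p q σ = K.vertexProduct σ *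
      (((p ^ 2)⁻¹) ^ displacementX σ * ((q ^ 2)⁻¹) ^ displacementY σ) := by
  change K.vertexProduct σ * _ = _
  by_cases h : K.vertexProduct σ = 0
  · rw [h, zero_mul, zero_mul]
  have hb := isBalanced_of_vertexProduct_ne_zero B h
  have hX : ∀ c : ℂ, (c ^ 2) ^ displacementX σ = c ^ displacementX σ * ∏ v : T.Vertex,
      c ^ ((σ (.inr (.horizontal, v))).toNat + (σ (.inr (.oblique, v))).toNat) := by
    intro c
    rw [Finset.prod_pow_eq_pow_sum, sum_internal_eq_displacementX hb]
    ring
  have hY : ∀ c : ℂ, (c ^ 2) ^ displacementY σ = c ^ displacementY σ * ∏ v : T.Vertex,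
      c ^ ((σ (.inr (.oblique, v))).toNat + (σ (.inr (.vertical, v))).toNat) := by
    intro c
    rw [Finset.prod_pow_eq_pow_sum, sum_internal_eq_displacementY hb]
    ring
  have hbool : ∀ (b : Bool) (c : ℂ), (if b = true then c else 1) = c ^ b.toNat := by
    intro b c
    cases b <;> simp
  have huniv : (Finset.univ : Finset Direction) = {.horizontal, .oblique, .vertical} := rfl
  congr 1
  rw [← inv_pow, ← inv_pow, hX, hY, displacementX, displacementY, ← Finset.prod_pow_eq_pow_sum,
    ← Finset.prod_pow_eq_pow_sum, Fintype.prod_prod_type, huniv,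
    Finset.prod_insert (by simp), Finset.prod_insert (by simp), Finset.prod_singleton,
    ← Finset.prod_mul_distrib, ← Finset.prod_mul_distrib, ← Finset.prod_mul_distrib,
    ← Finset.prod_mul_distrib, ← Finset.prod_mul_distrib]
  refine Finset.prod_congr rfl fun v _ => ?_
  simp only [hbool, arrowWeight]
  ring

end KagomeWeights

/-! ### The statistical sum and the determinant as Laurent polynomials in `x`, `y` -/

namespace KagomeWeights

variable {T : TorusLattice}

/-- The homology classes `(m σ, n σ)` of the arrow configurations, relative to the basis cycles,
for all configurations that have a non-zero weight for some choice of the vertex matrices, and the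
expansion of the determinant with the signs that these classes determine. -/
structure HomologyClasses (T : TorusLattice) where
  m : (KagomeEdge T → Bool) → ℤ
  n : (KagomeEdge T → Bool) → ℤ
  displacementX_eq : ∀ (K : KagomeWeights T) (σ : KagomeEdge T → Bool), K.vertexProduct σ ≠ 0 →
    (displacementX σ : ℤ) = m σ * T.a.1 + n σ * T.b.1
  displacementY_eq : ∀ (K : KagomeWeights T) (σ : KagomeEdge T → Bool), K.vertexProduct σ ≠ 0 →
    (displacementY σ : ℤ) = m σ * T.a.2 + n σ * T.b.2
  det_eq : ∀ K : KagomeWeights T, (1 - K.factor₁ * K.factor₂ * K.factor₃).det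
    = ∑ σ, (((m σ + n σ + m σ * n σ).negOnePow : ℤ) : ℂ) * K.vertexProduct σ

theorem nonempty_homologyClasses (T : TorusLattice) : Nonempty (HomologyClasses T) := by
  obtain ⟨B⟩ := nonempty_sliceBasis T
  have h : ∀ σ : KagomeEdge T → Bool, ∃ m n : ℤ, ∀ hσ : B.grid.IsBalanced (gridConfig σ),
      (displacementX σ : ℤ) = m * T.a.1 + n * T.b.1 ∧
      (displacementY σ : ℤ) = m * T.a.2 + n * T.b.2 ∧
      (Fintype.card {e // gridConfig σ e = true} : ℤ).negOnePow * (B.grid.flow hσ).sign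
        = (m + n + m * n).negOnePow := by
    intro σ
    by_cases hσ : B.grid.IsBalanced (gridConfig σ)
    · obtain ⟨m, n, hmn⟩ := exists_homology_class B hσ
      exact ⟨m, n, fun _ => hmn⟩
    · exact ⟨0, 0, fun h => absurd h hσ⟩
  choose m n hmn using h
  exact ⟨⟨m, n, fun K σ hK => (hmn σ (isBalanced_of_vertexProduct_ne_zero B hK)).1,
    fun K σ hK => (hmn σ (isBalanced_of_vertexProduct_ne_zero B hK)).2.1,
    fun K => K.det_eq_sum B fun σ hσ => (hmn σ hσ).2.2⟩⟩

namespace HomologyClasses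

variable (C : HomologyClasses T) (K : KagomeWeights T)

/-- The statistical sum as a Laurent polynomial in `x`, `y`. -/
noncomputable def sumPoly (x y : ℂˣ) : ℂ :=
  ∑ σ, K.vertexProduct σ * ((x ^ C.m σ * y ^ C.n σ : ℂˣ) : ℂ)

/-- The determinant as a Laurent polynomial in `x`, `y`. -/
noncomputable def detPoly (x y : ℂˣ) : ℂ :=
  ∑ σ, (((C.m σ + C.n σ + C.m σ * C.n σ).negOnePow : ℤ) : ℂ) *
    (K.vertexProduct σ * ((x ^ C.m σ * y ^ C.n σ : ℂˣ) : ℂ))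

theorem cycle_zpow_eq (u w : ℂˣ) {σ : KagomeEdge T → Bool} (hσ : K.vertexProduct σ ≠ 0) :
    ((T.cycleX u w ^ C.m σ * T.cycleY u w ^ C.n σ : ℂˣ) : ℂ)
      = ((u : ℂ)⁻¹) ^ displacementX σ * ((w : ℂ)⁻¹) ^ displacementY σ := by
  have h : T.cycleX u w ^ C.m σ * T.cycleY u w ^ C.n σ
      = u⁻¹ ^ displacementX σ * w⁻¹ ^ displacementY σ := by
    rw [TorusLattice.cycleX, TorusLattice.cycleY, mul_zpow, mul_zpow, ← zpow_mul, ← zpow_mul,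
      ← zpow_mul, ← zpow_mul, mul_mul_mul_comm, ← zpow_add, ← zpow_add, ← zpow_natCast,
      ← zpow_natCast, C.displacementX_eq K σ hσ, C.displacementY_eq K σ hσ, inv_zpow', inv_zpow']
    congr 2 <;> ring
  rw [h]
  simp

theorem statSumOfRoots_eq (p q : ℂ) (u w : ℂˣ) (hp : p ^ 2 = u) (hq : q ^ 2 = w) :
    K.statSumOfRoots p q = C.sumPoly K (T.cycleX u w) (T.cycleY u w) := by
  obtain ⟨B⟩ := nonempty_sliceBasis T
  refine Finset.sum_congr rfl fun σ _ => ?_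
  rw [configWeight_eq B, hp, hq]
  by_cases h : K.vertexProduct σ = 0
  · rw [h, zero_mul, zero_mul]
  · rw [C.cycle_zpow_eq K u w h]

theorem statSum_eq (u w : ℂˣ) :
    K.statSum u w = C.sumPoly K (T.cycleX u w) (T.cycleY u w) := by
  refine C.statSumOfRoots_eq K _ _ u w ?_ ?_ <;>
    rw [← Complex.cpow_nat_mul] <;> norm_num

theorem integralOfMotion_eq (u w : ℂˣ) :
    T.integralOfMotion (K.factor₁ * K.factor₂ * K.factor₃) u w
      = C.detPoly K (T.cycleX u w) (T.cycleY u w) := by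
  obtain ⟨B⟩ := nonempty_sliceBasis T
  rw [integralOfMotion_eq_det, C.det_eq]
  refine Finset.sum_congr rfl fun σ _ => ?_
  rw [vertexProduct_scale]
  by_cases h : K.vertexProduct σ = 0
  · rw [h, zero_mul, zero_mul]
  · rw [C.cycle_zpow_eq K u w h,
      sum_internal_eq_displacementX (isBalanced_of_vertexProduct_ne_zero B h)]

/-- The effect of sign changes of `x` and `y` on a monomial `t = x ^ m * y ^ n`. The sign
`e = (-1) ^ (m + n + m * n)` satisfies `-e + e (-1) ^ m + e (-1) ^ n + e (-1) ^ (m + n) = 2`. -/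
theorem monomial_signs (x y : ℂˣ) (m n : ℤ) : ∃ i j : ℂ,
    (((-x) ^ m * y ^ n : ℂˣ) : ℂ) = i * ((x ^ m * y ^ n : ℂˣ) : ℂ) ∧
    ((x ^ m * (-y) ^ n : ℂˣ) : ℂ) = j * ((x ^ m * y ^ n : ℂˣ) : ℂ) ∧
    (((-x) ^ m * (-y) ^ n : ℂˣ) : ℂ) = i * j * ((x ^ m * y ^ n : ℂˣ) : ℂ) ∧
    (((m + n + m * n).negOnePow : ℤ) : ℂ) * (-1 + i + j + i * j) = 2 ∧
    (((m + n + m * n).negOnePow : ℤ) : ℂ) * 2 = -1 + i + j + i * j := by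
  rcases Int.even_or_odd m with hm | hm <;> rcases Int.even_or_odd n with hn | hn
  · refine ⟨1, 1, ?_⟩
    rw [Int.negOnePow_even _ ((hm.add hn).add (hm.mul_right n)), hm.neg_zpow, hn.neg_zpow]
    norm_num
  · refine ⟨1, -1, ?_⟩
    rw [Int.negOnePow_odd _ ((hm.add_odd hn).add_even (hm.mul_right n)), hm.neg_zpow, hn.neg_zpow]
    norm_num
  · refine ⟨-1, 1, ?_⟩
    rw [Int.negOnePow_odd _ ((hm.add_even hn).add_even (hn.mul_left m)), hm.neg_zpow, hn.neg_zpow]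
    norm_num
  · refine ⟨-1, -1, ?_⟩
    rw [Int.negOnePow_odd _ ((hm.add_odd hn).add_odd (hm.mul hn)), hm.neg_zpow, hn.neg_zpow]
    norm_num

theorem sumPoly_eq (x y : ℂˣ) : C.sumPoly K x y
    = (1 / 2) * (-C.detPoly K x y + C.detPoly K (-x) y + C.detPoly K x (-y)
      + C.detPoly K (-x) (-y)) := by
  rw [sumPoly, detPoly, detPoly, detPoly, detPoly, ← Finset.sum_neg_distrib,
    ← Finset.sum_add_distrib, ← Finset.sum_add_distrib, ← Finset.sum_add_distrib, Finset.mul_sum]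
  refine Finset.sum_congr rfl fun σ _ => ?_
  obtain ⟨i, j, h1, h2, h3, h4, -⟩ := monomial_signs x y (C.m σ) (C.n σ)
  rw [h1, h2, h3]
  linear_combination
    (-1 / 2) * K.vertexProduct σ * ((x ^ C.m σ * y ^ C.n σ : ℂˣ) : ℂ) * h4

theorem detPoly_eq (x y : ℂˣ) : C.detPoly K x y
    = (1 / 2) * (-C.sumPoly K x y + C.sumPoly K (-x) y + C.sumPoly K x (-y)
      + C.sumPoly K (-x) (-y)) := by
  rw [detPoly, sumPoly, sumPoly, sumPoly, sumPoly, ← Finset.sum_neg_distrib,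
    ← Finset.sum_add_distrib, ← Finset.sum_add_distrib, ← Finset.sum_add_distrib, Finset.mul_sum]
  refine Finset.sum_congr rfl fun σ _ => ?_
  obtain ⟨i, j, h1, h2, h3, -, h5⟩ := monomial_signs x y (C.m σ) (C.n σ)
  rw [h1, h2, h3]
  linear_combination
    (1 / 2) * K.vertexProduct σ * ((x ^ C.m σ * y ^ C.n σ : ℂˣ) : ℂ) * h5

end HomologyClasses

end KagomeWeights

theorem TorusLattice.eq_of_cycle_eq (T : TorusLattice) {s s' : ℂˣ → ℂˣ → ℂ}
    (h : ∀ u w, s (T.cycleX u w) (T.cycleY u w) = s' (T.cycleX u w) (T.cycleY u w)) : s = s' := by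
  funext x y
  obtain ⟨u, w, rfl, rfl⟩ := T.exists_cycle_eq x y
  exact h u w

theorem theorem1 (T : TorusLattice) (A : T.EdgeMatrix) (hA : T.IsLocal A)
    (K : KagomeWeights T) (hK : K.Factorizes A) :
    -- `S(u, w)` does not depend on the choice of the square roots of `u`, `w`
    (∀ p q : ℂˣ, K.statSumOfRoots p q = K.statSum (p ^ 2) (q ^ 2)) ∧
    -- the statistical sum is conserved by the evolution
    (∀ (k : ℕ) (A' : T.EdgeMatrix) (K' : KagomeWeights T),
      T.IsLocal A' → K'.Factorizes A' → T.EvolvesIn k A A' →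
        ∀ u w : ℂˣ, K'.statSum u w = K.statSum u w) ∧
    -- the vanishing of `I(u, w)` defines the invariant curve
    (∀ u w : ℂˣ, T.integralOfMotion A u w = 0 ↔
      ((u : ℂ), (u : ℂ) * (w : ℂ), (w : ℂ)) ∈ T.invariantCurve A) ∧
    -- `s(x, y) = S(u, w)` and `f(x, y) = I(u, w)` define unique functions of `x`, `y`
    (∃! s : ℂˣ → ℂˣ → ℂ, ∀ u w : ℂˣ, s (T.cycleX u w) (T.cycleY u w) = K.statSum u w) ∧
    (∃! f : ℂˣ → ℂˣ → ℂ, ∀ u w : ℂˣ,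
      f (T.cycleX u w) (T.cycleY u w) = T.integralOfMotion A u w) ∧
    -- the two inversion formulae
    (∀ s f : ℂˣ → ℂˣ → ℂ,
      (∀ u w : ℂˣ, s (T.cycleX u w) (T.cycleY u w) = K.statSum u w) →
      (∀ u w : ℂˣ, f (T.cycleX u w) (T.cycleY u w) = T.integralOfMotion A u w) →
      ∀ x y : ℂˣ,
        s x y = (1 / 2) * (-f x y + f (-x) y + f x (-y) + f (-x) (-y)) ∧
        f x y = (1 / 2) * (-s x y + s (-x) y + s x (-y) + s (-x) (-y))) := by
  obtain ⟨C⟩ := KagomeWeights.nonempty_homologyClasses T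
  have hS := C.statSum_eq K
  have hI := C.integralOfMotion_eq K
  rw [← show A = K.factor₁ * K.factor₂ * K.factor₃ from hK] at hI
  refine ⟨fun p q => ?_, fun k A' K' _ hK' hev u w => ?_, T.integralOfMotion_eq_zero_iff A,
    ⟨C.sumPoly K, fun u w => (hS u w).symm, fun s hs => ?_⟩,
    ⟨C.detPoly K, fun u w => (hI u w).symm, fun f hf => ?_⟩, fun s f hs hf => ?_⟩
  · rw [hS]
    exact C.statSumOfRoots_eq K p q _ _ (by simp) (by simp)
  · have hI' := C.integralOfMotion_eq K'
    rw [← show A' = K'.factor₁ * K'.factor₂ * K'.factor₃ from hK'] at hI'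
    have hdet : C.detPoly K' = C.detPoly K := T.eq_of_cycle_eq fun u w => by
      rw [← hI, ← hI', TorusLattice.integralOfMotion_of_evolvesIn hev]
    rw [hS, C.statSum_eq K', C.sumPoly_eq, C.sumPoly_eq, hdet]
  · exact T.eq_of_cycle_eq fun u w => by rw [hs, hS]
  · exact T.eq_of_cycle_eq fun u w => by rw [hf, hI]
  · obtain rfl : s = C.sumPoly K := T.eq_of_cycle_eq fun u w => by rw [hs, hS]
    obtain rfl : f = C.detPoly K := T.eq_of_cycle_eq fun u w => by rw [hf, hI]
    exact fun x y => ⟨C.sumPoly_eq K x y, C.detPoly_eq K x y⟩
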